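/- Let $q$ be a prime power, let $r\ge 3$ and $\ell\ge 0$ be integers, and let $K=\mathbb F_{q^r}$. Let $\mathcal N_{q,r}$ be the norm-trace curve over $K$ with affine equation $$X^{\frac{q^r-1}{q-1}}=Y^{q^{r-1}}+Y^{q^{r-2}}+\cdots+Y,$$ let $K(\mathcal N_{q,r})=K(x,y)$ be its function field over $K$, and let $\mathcal N_{q,r}(K)$ be the set of its $K$-rational places (including the place at infinity). Let $\Omega$ be the set of the $K$-rational places that are zeros of $x$, let $\Theta=\mathcal N_{q,r}(K)\setminus\Omega$, and put $$G=\sum_{P\in\Omega}\ell P,\qquad D=\sum_{P\in\Theta}P=P_1+\cdots+P_n .$$ Let $\mathcal L(G)=\{f\in K(\mathcal N_{q,r})\setminus\{0\}\mid (f)+G\ge 0\}\cup\{0\}$ and let $$C=C_{\mathcal L}(D,G)=\{(f(P_1),\ldots,f(P_n))\mid f\in\mathcal L(G)\}\subseteq K^n .$$ Then $\Omega$ and $\Theta$ are finite, and the designed minimum distance $d^*=n-\deg G$ of $C$ is $$d^*=q^{2r-1}+1-(\ell+1)q^{r-1}.$$ Whenever $d^*>0$, the code $C$ attains it: the minimum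 distance of $C$ (the least Hamming distance between two distinct codewords) is equal to $d^*$. -/

import Mathlib

open Polynomial
open scoped Polynomial

/-! ### Places, divisors and Riemann-Roch spaces of an extension `F / K` of fields -/

/-- A place of the function field `F / K`, given by its valuation ring: a discrete valuation ring
of `F` that contains the constants `K`. -/
structure Place (K F : Type*) [Field K] [Field F] [Algebra K F] where
  /-- the valuation ring of the place -/
  ring : ValuationSubring F
  algebraMap_mem : ∀ a : K, algebraMap K F a ∈ ring
  isDVR : IsDiscreteValuationRing ring

namespace Place

variable {K F : Type*} [Field K] [Field F] [Algebra K F]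

instance (P : Place K F) : IsDiscreteValuationRing P.ring := P.isDVR

noncomputable instance (P : Place K F) : Algebra K P.ring :=
  ((algebraMap K F).codRestrict P.ring.toSubring P.algebraMap_mem).toAlgebra

/-- The residue class field of a place, an extension of `K`. -/
abbrev ResidueField (P : Place K F) : Type _ := IsLocalRing.ResidueField P.ring

/-- The degree of a place: the degree of its residue class field over `K`. -/
noncomputable def degree (P : Place K F) : ℕ := Module.finrank K P.ResidueField

/-- A place is `K`-rational if its degree is one. -/
def IsRational (P : Place K F) : Prop := P.degree = 1

/-- The normalized multiplicative valuation of a place. -/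
noncomputable def val (P : Place K F) : Valuation F (WithZero (Multiplicative ℤ)) :=
  (IsDiscreteValuationRing.maximalIdeal P.ring).valuation F

/-- The order of `f` at the place `P`: positive at zeros and negative at poles
(with the value `0` for `f = 0`). -/
noncomputable def ord (P : Place K F) (f : F) : ℤ := -WithZero.log (P.val f)

/-- `P.HasValue f a`: the function `f` is regular at `P`, and `f(P) = a`,
that is, the residue class of `f` at `P` is the constant `a ∈ K`. -/
def HasValue (P : Place K F) (f : F) (a : K) : Prop :=
  ∃ h : f ∈ P.ring, IsLocalRing.residue P.ring ⟨f, h⟩ = algebraMap K P.ResidueField a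

theorem val_algebraMap_le (P : Place K F) (a : K) : P.val (algebraMap K F a) ≤ 1 :=
  (IsDiscreteValuationRing.maximalIdeal P.ring).valuation_le_one (K := F)
    ⟨algebraMap K F a, P.algebraMap_mem a⟩

theorem nonneg_ord_add_iff (P : Place K F) {f : F} (hf : f ≠ 0) (n : ℤ) :
    0 ≤ P.ord f + n ↔ P.val f ≤ WithZero.exp n := by
  have h : P.val f ≠ 0 := (Valuation.ne_zero_iff _).2 hf
  rw [← WithZero.log_le_iff_le_exp h, ord]
  constructor <;> intro h <;> linarith

theorem HasValue.add {P : Place K F} {f g : F} {a b : K} (hf : P.HasValue f a)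
    (hg : P.HasValue g b) : P.HasValue (f + g) (a + b) := by
  obtain ⟨h1, e1⟩ := hf
  obtain ⟨h2, e2⟩ := hg
  refine ⟨P.ring.add_mem _ _ h1 h2, ?_⟩
  rw [map_add, ← e1, ← e2, ← map_add]
  rfl

theorem hasValue_algebraMap (P : Place K F) (a : K) : P.HasValue (algebraMap K F a) a :=
  ⟨P.algebraMap_mem a, rfl⟩

theorem HasValue.mul {P : Place K F} {f g : F} {a b : K} (hf : P.HasValue f a)
    (hg : P.HasValue g b) : P.HasValue (f * g) (a * b) := by
  obtain ⟨h1, e1⟩ := hf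
  obtain ⟨h2, e2⟩ := hg
  refine ⟨P.ring.mul_mem _ _ h1 h2, ?_⟩
  rw [map_mul, ← e1, ← e2, ← map_mul]
  rfl

end Place

/-- A divisor of `F / K`: a formal integral combination of finitely many places. -/
abbrev PlaceDivisor (K F : Type*) [Field K] [Field F] [Algebra K F] : Type _ := Place K F →₀ ℤ

section Codes

variable {K F : Type*} [Field K] [Field F] [Algebra K F]

/-- The degree of a divisor. -/
noncomputable def PlaceDivisor.deg (G : PlaceDivisor K F) : ℤ :=
  G.sum fun P n => n * (P.degree : ℤ)

/-- The Riemann-Roch space `L(G) = {f ≠ 0 | (f) + G ≥ 0} ∪ {0}`. -/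
noncomputable def riemannRochSpace (G : PlaceDivisor K F) : Submodule K F where
  carrier := {f | f = 0 ∨ ∀ P : Place K F, 0 ≤ P.ord f + G P}
  zero_mem' := Or.inl rfl
  add_mem' := by
    intro f g hf hg
    rcases eq_or_ne f 0 with rfl | hf0
    · simpa using hg
    rcases eq_or_ne g 0 with rfl | hg0
    · simpa using hf
    rcases eq_or_ne (f + g) 0 with h0 | h0
    · exact Or.inl h0
    refine Or.inr fun P => ?_
    have h1 := hf.resolve_left hf0 P
    have h2 := hg.resolve_left hg0 P
    rw [P.nonneg_ord_add_iff (by assumption)] at h1 h2 ⊢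
    exact (Valuation.map_add _ _ _).trans (max_le h1 h2)
  smul_mem' := by
    intro a f hf
    rcases eq_or_ne (a • f) 0 with h0 | h0
    · exact Or.inl h0
    have hf0 : f ≠ 0 := by rintro rfl; simp at h0
    refine Or.inr fun P => ?_
    have h1 := hf.resolve_left hf0 P
    rw [P.nonneg_ord_add_iff (by assumption)] at h1 ⊢
    rw [Algebra.smul_def, map_mul]
    exact (mul_le_of_le_one_left' (P.val_algebraMap_le a)).trans h1

/-- The functional code `C_L(D, G)`, for a sum `D = P₁ + ⋯ + Pₙ` of distinct rational places and
a divisor `G` whose support is disjoint from that of `D`: all the vectors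
`(f(P₁), …, f(Pₙ))` with `f ∈ L(G)`. The coordinates are indexed by the support of `D`. -/
noncomputable def functionalCode (D G : PlaceDivisor K F) : Submodule K (D.support → K) where
  carrier := {c | ∃ f ∈ riemannRochSpace G, ∀ P : D.support, P.1.HasValue f (c P)}
  zero_mem' := ⟨0, Submodule.zero_mem _, fun P => by
    simpa using P.1.hasValue_algebraMap (0 : K)⟩
  add_mem' := by
    rintro c d ⟨f, hf, hfc⟩ ⟨g, hg, hgd⟩
    exact ⟨f + g, Submodule.add_mem _ hf hg, fun P => (hfc P).add (hgd P)⟩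
  smul_mem' := by
    rintro a c ⟨f, hf, hfc⟩
    refine ⟨a • f, Submodule.smul_mem _ a hf, fun P => ?_⟩
    rw [Algebra.smul_def]
    exact (P.1.hasValue_algebraMap a).mul (hfc P)

/-- The designed minimum distance `n - deg G` of `C_L(D, G)`, where `n` is the length. -/
noncomputable def designedDistance (D G : PlaceDivisor K F) : ℤ :=
  (D.support.card : ℤ) - G.deg

end Codes

/-- `d` is the minimum distance of the linear code `C`: the least Hamming distance of two distinct
codewords. -/
def IsMinimumDistance {K ι : Type*} [Field K] [DecidableEq K] [Fintype ι]
    (C : Submodule K (ι → K)) (d : ℤ) : Prop :=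
  IsLeast {e : ℤ | ∃ c ∈ C, ∃ c' ∈ C, c ≠ c' ∧ e = (hammingDist c c' : ℤ)} d

/-! ### The norm-trace curve -/

namespace NormTrace

/-- The polynomial `T(Y) = Y^(q^(r-1)) + ⋯ + Y^q + Y`. -/
noncomputable def tracePoly (K : Type*) [Field K] (q r : ℕ) : K[X] :=
  ∑ i ∈ Finset.range r, (X : K[X]) ^ q ^ i

/-- The polynomial `X^((q^r-1)/(q-1)) - T(Y)`, as a polynomial in `X` over `K[Y]`. -/
noncomputable def poly (K : Type*) [Field K] (q r : ℕ) : K[X][X] :=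
  X ^ ((q ^ r - 1) / (q - 1)) - C (tracePoly K q r)

theorem exponent_pos {q r : ℕ} (hq : 1 < q) (hr : r ≠ 0) : 0 < (q ^ r - 1) / (q - 1) := by
  apply Nat.div_pos _ (by omega)
  have : q ≤ q ^ r := Nat.le_self_pow hr q
  omega

theorem coeff_tracePoly_one (K : Type*) [Field K] {q r : ℕ} (hq : 1 < q) (hr : r ≠ 0) :
    (tracePoly K q r).coeff 1 = 1 := by
  obtain ⟨s, rfl⟩ := Nat.exists_eq_succ_of_ne_zero hr
  rw [tracePoly, finsetSum_coeff, Finset.sum_eq_single 0]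
  · simp
  · intro i _ hi
    rw [coeff_X_pow, if_neg]
    exact (Nat.one_lt_pow hi hq).ne
  · simp

theorem X_dvd_tracePoly (K : Type*) [Field K] {q : ℕ} (r : ℕ) (hq : 1 < q) :
    (X : K[X]) ∣ tracePoly K q r :=
  Finset.dvd_sum fun i _ => dvd_pow_self _ (pow_pos (by omega) i).ne'

/-- The equation of the norm-trace curve is irreducible. -/
theorem irreducible_poly (K : Type*) [Field K] {q r : ℕ} (hq : 1 < q) (hr : r ≠ 0) :
    Irreducible (poly K q r) := by
  have hc := exponent_pos hq hr
  have hm : (poly K q r).Monic := monic_X_pow_sub_C _ hc.ne'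
  have hdeg : (poly K q r).degree = ((q ^ r - 1) / (q - 1) : ℕ) := degree_X_pow_sub_C hc _
  refine irreducible_of_eisenstein_criterion (P := Ideal.span {(X : K[X])})
    ((Ideal.span_singleton_prime X_ne_zero).2 prime_X) ?_ ?_ ?_ ?_ hm.isPrimitive
  · rw [hm.leadingCoeff, Ideal.mem_span_singleton]
    exact prime_X.not_dvd_one
  · intro n hn
    rw [hdeg] at hn
    have hn' : n < (q ^ r - 1) / (q - 1) := by exact_mod_cast hn
    rw [poly, coeff_sub, coeff_X_pow, if_neg hn'.ne, zero_sub, Ideal.neg_mem_iff,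
      Ideal.mem_span_singleton, coeff_C]
    split_ifs
    · exact X_dvd_tracePoly K r hq
    · exact dvd_zero _
  · rw [hdeg]
    exact_mod_cast hc
  · rw [poly, coeff_sub, coeff_X_pow, if_neg hc.ne, zero_sub, Ideal.neg_mem_iff, coeff_C_zero,
      Ideal.span_singleton_pow, Ideal.mem_span_singleton, X_pow_dvd_iff]
    intro h
    have := h 1 (by norm_num)
    rw [coeff_tracePoly_one K hq hr] at this
    exact one_ne_zero this

/-- The affine coordinate ring `K[X, Y] / (X^((q^r-1)/(q-1)) - T(Y))` of the curve. -/
abbrev CoordinateRing (K : Type*) [Field K] (q r : ℕ) : Type _ := AdjoinRoot (poly K q r)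

instance (K : Type*) [Field K] (q r : ℕ) [hq : Fact (IsPrimePow q)] [hr : NeZero r] :
    IsDomain (CoordinateRing K q r) :=
  AdjoinRoot.isDomain_of_prime (irreducible_poly K hq.out.one_lt hr.out).prime

/-- The field of `K`-rational functions on the norm-trace curve. -/
abbrev FunctionField (K : Type*) [Field K] (q r : ℕ) : Type _ :=
  FractionRing (CoordinateRing K q r)

variable (K : Type*) [Field K] (q r : ℕ)

/-- The coordinate function `x`. -/
noncomputable def x : FunctionField K q r :=
  algebraMap (CoordinateRing K q r) (FunctionField K q r) (AdjoinRoot.root (poly K q r))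

variable [Fact (IsPrimePow q)] [NeZero r]

/-- The set of the `K`-rational places of the norm-trace curve that are zeros of `x`. -/
def zerosOfX : Set (Place K (FunctionField K q r)) :=
  {P | P.IsRational ∧ 0 < P.ord (x K q r)}

/-- The set of the remaining `K`-rational places of the norm-trace curve
(the place at infinity is one of them). -/
def otherPlaces : Set (Place K (FunctionField K q r)) :=
  {P | P.IsRational} \ zerosOfX K q r

/-- The divisor `G`: the sum of `ℓ P` over the rational zeros `P` of `x`. -/
noncomputable def divisorG (l : ℕ) : PlaceDivisor K (FunctionField K q r) :=
  ∑ᶠ P ∈ zerosOfX K q r, Finsupp.single P (l : ℤ)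

/-- The divisor `D`: the sum of the remaining rational places. -/
noncomputable def divisorD : PlaceDivisor K (FunctionField K q r) :=
  ∑ᶠ P ∈ otherPlaces K q r, Finsupp.single P 1

end NormTrace

/-! ### Values, orders and rationality at a place. -/

namespace Place

variable {K F : Type*} [Field K] [Field F] [Algebra K F]

/-! Write A for the coordinate ring, N = (q^r-1)/(q-1) and s = q^(r-1). Since Ω has s places, deg G
= ls. It must be shown that a nonzero f in L(G) has at most ls zeros in Θ, and that some f has
exactly ls.

Bound. The poles of f lie in Ω, where x vanishes, so x^l f has no pole on the affine curve. Because
T' = 1, A is integrally closed (`isIntegrallyClosed_of_adjoin_pair`), hence Dedekind, and x^l f is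
an element g of A (`exists_algebraMap_eq_x_pow_mul`). As N and s are coprime, the basis monomials
y^d x^i with i < N have distinct pole orders Nd + si at infinity (`monomialWeight_injective`). Hence
exactly one place has y as a non-regular function, it is rational, and the pole order of g there is
the largest weight in its expansion (`valuation_eq_pow_weight`). Regularity of f at infinity gives
weight g ≤ ls, strictly if f vanishes there. The affine rational zeros of g number at most dim
A/(g), the degree of the norm of g to K[y], which is at most weight g (`card_zeros_le_weight`).
Together this is `card_zeros_le`.

Sharpness. If d* > 0 then l ≤ q^r - 1, so there is a set S of l nonzero elements of K. The product
of the (x - a)/x over a in S lies in L(G), because all zeros of x are rational and simple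
(`extremalFunction_mem`). Norms lie in the field of q elements, and each trace fibre over that field
has s elements (`card_trace_fibre`). So s points lie above each a in S, which makes ls zeros. -/

theorem ext_ring {P Q : Place K F} (h : P.ring = Q.ring) : P = Q := by
  cases P; cases Q; cases h; rfl

theorem val_le_one_iff (P : Place K F) {f : F} : P.val f ≤ 1 ↔ f ∈ P.ring := by
  constructor
  · intro h
    obtain ⟨a, rfl⟩ := IsDiscreteValuationRing.exists_lift_of_le_one h
    exact a.2
  · intro h
    exact (IsDiscreteValuationRing.maximalIdeal P.ring).valuation_le_one (K := F) ⟨f, h⟩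

theorem nonneg_ord_iff (P : Place K F) {f : F} (hf : f ≠ 0) : 0 ≤ P.ord f ↔ f ∈ P.ring := by
  have := P.nonneg_ord_add_iff hf 0
  rwa [add_zero, WithZero.exp_zero, val_le_one_iff] at this

theorem hasValue_zero_iff (P : Place K F) {f : F} : P.HasValue f 0 ↔ P.val f < 1 := by
  have key : ∀ h : f ∈ P.ring, IsLocalRing.residue P.ring ⟨f, h⟩ = 0 ↔ P.val f < 1 := by
    intro h
    rw [IsLocalRing.residue_eq_zero_iff]
    exact ((IsDiscreteValuationRing.maximalIdeal P.ring).valuation_lt_one_iff_mem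
      (K := F) ⟨f, h⟩).symm
  constructor
  · rintro ⟨h, e⟩
    rw [map_zero] at e
    exact (key h).1 e
  · intro h
    refine ⟨P.val_le_one_iff.1 h.le, ?_⟩
    rw [map_zero]
    exact (key _).2 h

theorem ord_pos_iff (P : Place K F) {f : F} (hf : f ≠ 0) : 0 < P.ord f ↔ P.HasValue f 0 := by
  have h : P.val f ≠ 0 := (Valuation.ne_zero_iff _).2 hf
  rw [hasValue_zero_iff, ← WithZero.exp_zero, ← WithZero.log_lt_iff_lt_exp h, ord]
  constructor <;> intro h <;> linarith

theorem hasValue_zero_or_inv_mem (P : Place K F) (f : F) :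
    P.HasValue f 0 ∨ (f ≠ 0 ∧ f⁻¹ ∈ P.ring) := by
  rw [hasValue_zero_iff, ← val_le_one_iff, map_inv₀]
  rcases lt_or_ge (P.val f) 1 with h | h
  · exact Or.inl h
  · refine Or.inr ⟨?_, ?_⟩
    · rintro rfl
      rw [map_zero] at h
      exact absurd h (by simp)
    · exact inv_le_one_of_one_le₀ h

/-- Links the integer-valued valuation of a place with the intrinsic valuation of its ring; the
place at infinity is studied through the latter. -/
theorem hasValue_zero_iff_valuation_lt_one (P : Place K F) {f : F} :
    P.HasValue f 0 ↔ P.ring.valuation f < 1 := by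
  rw [hasValue_zero_iff]
  rcases eq_or_ne f 0 with rfl | hf
  · simp
  · rw [← ValuationSubring.mem_nonunits_iff, ValuationSubring.mem_nonunits_iff_or,
      or_iff_right hf, ← val_le_one_iff, map_inv₀, not_le,
      one_lt_inv₀ (zero_lt_iff.2 ((Valuation.ne_zero_iff _).2 hf))]

theorem HasValue.unique {P : Place K F} {f : F} {a b : K} (ha : P.HasValue f a)
    (hb : P.HasValue f b) : a = b := by
  obtain ⟨h1, e1⟩ := ha
  obtain ⟨h2, e2⟩ := hb
  exact (algebraMap K P.ResidueField).injective (e1.symm.trans e2)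

theorem HasValue.sub {P : Place K F} {f g : F} {a b : K} (hf : P.HasValue f a)
    (hg : P.HasValue g b) : P.HasValue (f - g) (a - b) := by
  have h := hf.add ((P.hasValue_algebraMap (-1)).mul hg)
  convert h using 1
  · simp [sub_eq_add_neg]
  · ring

theorem HasValue.pow {P : Place K F} {f : F} {a : K} (hf : P.HasValue f a) (n : ℕ) :
    P.HasValue (f ^ n) (a ^ n) := by
  induction n with
  | zero => simpa using P.hasValue_algebraMap 1
  | succ n ih => simpa [pow_succ] using ih.mul hf

theorem HasValue.prod {P : Place K F} {ι : Type*} (s : Finset ι) {f : ι → F} {a : ι → K}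
    (h : ∀ i ∈ s, P.HasValue (f i) (a i)) : P.HasValue (∏ i ∈ s, f i) (∏ i ∈ s, a i) := by
  classical
  induction s using Finset.induction_on with
  | empty => simpa using P.hasValue_algebraMap 1
  | insert i s hi ih =>
    rw [Finset.prod_insert hi, Finset.prod_insert hi]
    exact (h i (Finset.mem_insert_self i s)).mul
      (ih fun j hj => h j (Finset.mem_insert_of_mem hj))

theorem HasValue.inv {P : Place K F} {f : F} {a : K} (hf : P.HasValue f a) (ha : a ≠ 0) :
    P.HasValue f⁻¹ a⁻¹ := by
  rcases P.hasValue_zero_or_inv_mem f with h | ⟨h0, h⟩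
  · exact absurd (hf.unique h) ha
  · obtain ⟨h1, e1⟩ := hf
    refine ⟨h, ?_⟩
    rw [map_inv₀]
    refine eq_inv_of_mul_eq_one_left ?_
    rw [← e1, ← map_mul]
    have : (⟨f⁻¹, h⟩ : P.ring) * ⟨f, h1⟩ = 1 := Subtype.ext (inv_mul_cancel₀ h0)
    rw [this, map_one]

theorem HasValue.aeval {P : Place K F} {f : F} {a : K} (hf : P.HasValue f a) (p : K[X]) :
    P.HasValue (aeval f p) (p.eval a) := by
  induction p using Polynomial.induction_on' with
  | add p q hp hq => simpa using hp.add hq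
  | monomial n c =>
    rw [aeval_monomial, eval_monomial]
    exact (P.hasValue_algebraMap c).mul (hf.pow n)

theorem hasValue_iff_sub (P : Place K F) {f : F} {a : K} :
    P.HasValue f a ↔ P.HasValue (f - algebraMap K F a) 0 := by
  constructor
  · intro h
    simpa using h.sub (P.hasValue_algebraMap a)
  · intro h
    simpa using h.add (P.hasValue_algebraMap a)

/-- Degree one says that K maps onto the residue field. -/
theorem isRational_iff (P : Place K F) :
    P.IsRational ↔ ∀ f ∈ P.ring, ∃ a, P.HasValue f a := by
  rw [IsRational, degree]
  constructor
  · intro h f hf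
    obtain ⟨a, ha⟩ := (finrank_eq_one_iff_of_nonzero' (1 : P.ResidueField) one_ne_zero).1 h
      (IsLocalRing.residue P.ring ⟨f, hf⟩)
    exact ⟨a, hf, by rw [← ha, Algebra.algebraMap_eq_smul_one]⟩
  · intro h
    have hs : Function.Surjective (algebraMap K P.ResidueField) := by
      intro z
      obtain ⟨⟨f, hf⟩, rfl⟩ := IsLocalRing.residue_surjective z
      obtain ⟨a, _, e⟩ := h f hf
      exact ⟨a, e.symm⟩
    exact Module.finrank_of_bijective_algebraMap ⟨RingHom.injective _, hs⟩

theorem ring_ne_top (P : Place K F) : P.ring ≠ ⊤ := by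
  intro h
  obtain ⟨z, hz⟩ := IsDiscreteValuationRing.exists_irreducible P.ring
  refine hz.not_isUnit ?_
  have h0 : (z : F) ≠ 0 := fun h => hz.ne_zero (Subtype.ext h)
  have hm : (z : F)⁻¹ ∈ P.ring := (SetLike.ext_iff.1 h _).2 (ValuationSubring.mem_top _)
  exact IsUnit.of_mul_eq_one ⟨_, hm⟩ (Subtype.ext (mul_inv_cancel₀ h0))

/-- If every function vanishing at `P` is a multiple of `t` in the ring of `P`, then `t` is a
uniformizer. -/
theorem val_eq_exp_neg_one_of_forall_dvd (P : Place K F) {t : F} (ht : P.HasValue t 0)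
    (h : ∀ f, P.HasValue f 0 → ∃ g ∈ P.ring, f = t * g) : P.val t = WithZero.exp (-1) := by
  obtain ⟨hm, -⟩ := id ht
  rw [hasValue_zero_iff] at ht
  obtain ⟨z, hz⟩ := (IsDiscreteValuationRing.maximalIdeal P.ring).valuation_exists_uniformizer F
  have hz' : P.val z = WithZero.exp (-1) := hz
  have hz1 : P.HasValue z 0 := by
    rw [hasValue_zero_iff, hz', ← WithZero.exp_zero, WithZero.exp_lt_exp]
    norm_num
  obtain ⟨g, hg, rfl⟩ := h z hz1
  rw [map_mul] at hz'
  rw [← val_le_one_iff] at hg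
  have hle : WithZero.exp (-1 : ℤ) ≤ P.val t := by
    rw [← hz']
    exact mul_le_of_le_one_right' hg
  have h0 : P.val t ≠ 0 := fun h0 => by
    rw [h0] at hle; simp at hle
  refine le_antisymm ?_ hle
  rw [← WithZero.exp_zero, ← WithZero.log_lt_iff_lt_exp h0] at ht
  rw [← WithZero.log_le_iff_le_exp h0]
  omega

end Place

/-! ### A criterion for integral closedness. -/

/-- If `L` is generated over the fraction field `E` of an integrally closed domain `R` by a root
`y` of a monic polynomial over `R` whose derivative takes the value `1` at `y`, then `R[y]`
contains all the elements of `L` that are integral over `R`. -/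
theorem mem_adjoin_of_isIntegral_of_derivative_eq_one {R E L : Type*} [CommRing R] [IsDomain R]
    [IsIntegrallyClosed R] [Field E] [Algebra R E] [IsFractionRing R E] [Field L] [Algebra E L]
    [Algebra R L] [IsScalarTower R E L] {y : L} (hy : IntermediateField.adjoin E {y} = ⊤)
    {P : R[X]} (hP : P.Monic) (hPy : aeval y P = 0) (hPy' : aeval y P.derivative = 1)
    {z : L} (hz : IsIntegral R z) : z ∈ Algebra.adjoin R {y} := by
  have hyR : IsIntegral R y := ⟨P, hP, hPy⟩
  have hyE : IsIntegral E y := hyR.tower_top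
  have hinj : FaithfulSMul R L := by
    rw [faithfulSMul_iff_algebraMap_injective, IsScalarTower.algebraMap_eq R E L]
    exact (algebraMap E L).injective.comp (IsFractionRing.injective R E)
  have hmin : minpoly E y = (minpoly R y).map (algebraMap R E) :=
    minpoly.isIntegrallyClosed_eq_field_fractions E L hyR
  obtain ⟨h, hh⟩ := minpoly.isIntegrallyClosed_dvd hyR hPy
  -- With μ the minimal polynomial, P = μh; differentiating at y leaves μ'(y) h(y) = P'(y) = 1. So y
  -- is separable and μ'(y) is a unit of R[y].
  have hder : aeval y (minpoly E y).derivative * aeval y h = 1 := by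
    rw [hh, derivative_mul, map_add, map_mul, map_mul, minpoly.aeval, zero_mul, add_zero] at hPy'
    rw [hmin, derivative_map, aeval_map_algebraMap]
    exact hPy'
  have hsep : IsSeparable E y := by
    refine (separable_iff_derivative_ne_zero (minpoly.irreducible hyE)).2 fun h0 => ?_
    rw [h0, map_zero, zero_mul] at hder
    exact zero_ne_one hder
  have : Algebra.IsSeparable E L := by
    have h1 := (IntermediateField.isSeparable_adjoin_simple_iff_isSeparable E L).2 hsep
    rw [hy] at h1
    exact Algebra.IsSeparable.of_algHom E (⊤ : IntermediateField E L)
      IntermediateField.topEquiv.symm.toAlgHom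
  let B : PowerBasis E L := PowerBasis.ofAdjoinEqTop' hyE (by
    rw [← IntermediateField.adjoin_simple_toSubalgebra_of_isAlgebraic hyE.isAlgebraic, hy]; rfl)
  have hgen : B.gen = y := PowerBasis.ofAdjoinEqTop'_gen _ _
  have : FiniteDimensional E L := B.finite
  have hhint : IsIntegral R (Algebra.norm E (aeval y h)) :=
    Algebra.isIntegral_norm E 
      (adjoin_le_integralClosure hyR (aeval_mem_adjoin_singleton R y))
  -- The discriminant of the power basis is, up to sign, the norm of μ'(y). Its inverse, up to the
  -- same sign, is the norm of h(y), which lies in R; so the discriminant can be cancelled.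
  have hdisc := Algebra.discr_mul_isIntegral_mem_adjoin E (B := B) (by rwa [hgen]) hz
  rw [Algebra.discr_powerBasis_eq_norm, hgen] at hdisc
  obtain ⟨u, hu⟩ := IsIntegrallyClosed.isIntegral_iff.1 hhint
  have hm := Subalgebra.smul_mem _ hdisc
    ((-1) ^ (Module.finrank E L * (Module.finrank E L - 1) / 2) * u : R)
  convert hm using 1
  have hnorm := congrArg (Algebra.norm E) hder
  rw [map_mul, map_one] at hnorm
  rw [← algebraMap_smul E, smul_smul, map_mul, hu, map_pow, map_neg, map_one]
  conv_lhs => rw [← one_smul E z, ← hnorm]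
  congr 1
  have hs : ((-1 : E) ^ (Module.finrank E L * (Module.finrank E L - 1) / 2)) *
      (-1) ^ (Module.finrank E L * (Module.finrank E L - 1) / 2) = 1 := by
    rw [← mul_pow]; simp
  linear_combination
    -(Algebra.norm E (aeval y h) * Algebra.norm E (aeval y (minpoly E y).derivative)) * hs

open scoped IntermediateField.algebraAdjoinAdjoin in
theorem isFractionRing_adjoin (K : Type*) {F : Type*} [Field K] [Field F] [Algebra K F]
    (S : Set F) : IsFractionRing (Algebra.adjoin K S) (IntermediateField.adjoin K S) :=
  inferInstance

open scoped IntermediateField.algebraAdjoinAdjoin in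
/-- A domain generated over a field `K` by elements `x` and `y` with `T(y) = x ^ n` is integrally
closed if `x` is transcendental and the monic polynomial `T` has derivative `1`. -/
theorem isIntegrallyClosed_of_adjoin_pair {K A F : Type*} [Field K] [CommRing A] [IsDomain A]
    [Algebra K A] [Field F] [Algebra A F] [IsFractionRing A F] [Algebra K F]
    [IsScalarTower K A F] {x y : A} (hx : Transcendental K (algebraMap A F x))
    (hxy : Algebra.adjoin K {x, y} = ⊤) {T : K[X]} (hT : T.Monic) (hT0 : 0 < T.degree)
    (hT' : derivative T = 1) {n : ℕ} (h : aeval y T = x ^ n) : IsIntegrallyClosed A := by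
  let R := Algebra.adjoin K {algebraMap A F x}
  let E := IntermediateField.adjoin K {algebraMap A F x}
  have hR : IsIntegrallyClosed R :=
    IsIntegrallyClosed.of_equiv
      (Polynomial.algEquivOfTranscendental K (algebraMap A F x) hx).toRingEquiv
  let xR : R := ⟨algebraMap A F x, Algebra.self_mem_adjoin_singleton K _⟩
  -- The curve is read as a monic equation for y over the polynomial ring K[x]; its derivative in Y
  -- is T' = 1.
  let P : R[X] := T.map (algebraMap K R) - C (xR ^ n)
  have hP : P.Monic := (hT.map _).sub_of_left (degree_C_le.trans_lt (by rwa [hT.degree_map]))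
  have hPy : aeval (algebraMap A F y) P = 0 := by
    rw [map_sub, aeval_map_algebraMap, aeval_C, aeval_algebraMap_apply, h, map_pow, map_pow,
      sub_eq_zero]
    rfl
  have hPy' : aeval (algebraMap A F y) P.derivative = 1 := by
    rw [derivative_sub, derivative_C, sub_zero, derivative_map, hT', Polynomial.map_one, map_one]
  -- Applied below to two subrings: the field E(y) and the integral closure of R.
  have hind : ∀ C : Subring F, (∀ a : K, algebraMap K F a ∈ C) → algebraMap A F x ∈ C →
      algebraMap A F y ∈ C → ∀ g, algebraMap A F g ∈ C := by
    intro C hC hxC hyC g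
    have hg : g ∈ Algebra.adjoin K {x, y} := hxy ▸ Algebra.mem_top
    induction hg using Algebra.adjoin_induction with
    | mem z hz =>
      rcases hz with rfl | rfl
      · exact hxC
      · exact hyC
    | algebraMap a =>
      rw [← IsScalarTower.algebraMap_apply]
      exact hC a
    | add f g _ _ hf hg => rw [map_add]; exact add_mem hf hg
    | mul f g _ _ hf hg => rw [map_mul]; exact mul_mem hf hg
  have hgen : IntermediateField.adjoin E {algebraMap A F y} = ⊤ := by
    rw [eq_top_iff]
    intro f _
    have hA := hind (IntermediateField.adjoin E {algebraMap A F y}).toSubring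
      (fun a => by
        rw [IsScalarTower.algebraMap_apply K E F]
        exact IntermediateField.algebraMap_mem (IntermediateField.adjoin E {algebraMap A F y}) _)
      (IntermediateField.algebraMap_mem (IntermediateField.adjoin E {algebraMap A F y})
          (IntermediateField.AdjoinSimple.gen K (algebraMap A F x)))
      (IntermediateField.mem_adjoin_simple_self E _)
    obtain ⟨g, h, -, rfl⟩ := IsFractionRing.div_surjective A f
    exact div_mem (S := IntermediateField E F) (hA g) (hA h)
  have hA : ∀ g : A, IsIntegral R (algebraMap A F g) :=
    hind (integralClosure R F).toSubring
      (fun a => by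
        rw [IsScalarTower.algebraMap_apply K R F]
        exact isIntegral_algebraMap)
      (isIntegral_algebraMap (R := R) (A := F) (x := xR)) ⟨P, hP, hPy⟩
  rw [isIntegrallyClosed_iff F]
  intro z hz
  have hzR : IsIntegral R z := by
    let φ : A →+* integralClosure R F := (algebraMap A F).codRestrict (integralClosure R F) hA
    have h1 : IsIntegral (integralClosure R F) z := by
      obtain ⟨p, hp, hpz⟩ := hz
      refine ⟨p.map φ, hp.map _, ?_⟩
      rw [eval₂_map]
      exact hpz
    exact isIntegral_trans (R := R) (A := integralClosure R F) z h1
  have hfrac : IsFractionRing (Algebra.adjoin K {algebraMap A F x})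
      (IntermediateField.adjoin K {algebraMap A F x}) :=
    isFractionRing_adjoin K {algebraMap A F x}
  have hmem := mem_adjoin_of_isIntegral_of_derivative_eq_one (E := E) hgen hP hPy hPy' hzR
  have hRA : R ≤ (IsScalarTower.toAlgHom K A F).range := by
    refine Algebra.adjoin_le ?_
    rintro _ rfl
    exact ⟨x, rfl⟩
  let S : Subalgebra R F :=
    { (algebraMap A F).range with
      algebraMap_mem' := fun c => hRA c.2 }
  have hS : Algebra.adjoin R {algebraMap A F y} ≤ S := Algebra.adjoin_le (by
    rintro _ rfl
    exact ⟨y, rfl⟩)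
  exact hS hmem

/-! ### The coordinate ring of the norm-trace curve is Dedekind. -/

namespace NormTrace

/-- The exponent `(q^r - 1)/(q - 1)` of the norm. -/
abbrev normExponent (q r : ℕ) : ℕ := (q ^ r - 1) / (q - 1)

section TracePoly

variable (K : Type*) [Field K] {q r : ℕ}

theorem degree_tracePoly_sub_lt (hq : 1 < q) (n : ℕ) :
    (tracePoly K q (n + 1) - X ^ q ^ n).degree < ((q ^ n : ℕ) : WithBot ℕ) := by
  rw [tracePoly, Finset.sum_range_succ, add_sub_cancel_right]
  refine (degree_sum_le _ _).trans_lt ?_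
  rw [Finset.sup_lt_iff (WithBot.bot_lt_coe _)]
  intro i hi
  rw [degree_X_pow]
  exact_mod_cast Nat.pow_lt_pow_right hq (Finset.mem_range.1 hi)

theorem monic_tracePoly (hq : 1 < q) (hr : r ≠ 0) : (tracePoly K q r).Monic := by
  obtain ⟨n, rfl⟩ := Nat.exists_eq_succ_of_ne_zero hr
  have h := monic_X_pow_add (degree_tracePoly_sub_lt K hq n)
  rwa [add_sub_cancel] at h

theorem natDegree_tracePoly (hq : 1 < q) (hr : r ≠ 0) :
    (tracePoly K q r).natDegree = q ^ (r - 1) := by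
  obtain ⟨n, rfl⟩ := Nat.exists_eq_succ_of_ne_zero hr
  have h2 : (tracePoly K q (n + 1)).degree = ((q ^ n : ℕ) : WithBot ℕ) := by
    have := degree_add_eq_left_of_degree_lt
      ((degree_tracePoly_sub_lt K hq n).trans_eq (degree_X_pow (R := K) (q ^ n)).symm)
    rw [add_sub_cancel, degree_X_pow] at this
    exact this
  exact natDegree_eq_of_degree_eq_some h2

/-- Only the linear term survives, since q vanishes in K. Both the smoothness of the curve and the
simplicity of the zeros of x rest on this. -/
theorem derivative_tracePoly (hr : r ≠ 0) (hqK : (q : K) = 0) :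
    derivative (tracePoly K q r) = 1 := by
  obtain ⟨n, rfl⟩ := Nat.exists_eq_succ_of_ne_zero hr
  rw [tracePoly, derivative_sum, Finset.sum_range_succ', Finset.sum_eq_zero, zero_add]
  · simp
  · intro i _
    rw [derivative_X_pow, Nat.cast_pow, hqK, zero_pow (Nat.succ_ne_zero i), C_0, zero_mul]

end TracePoly

variable (K : Type*) [Field K] (q r : ℕ)

theorem monic_poly (hq : 1 < q) (hr : r ≠ 0) : (poly K q r).Monic :=
  monic_X_pow_sub_C _ (exponent_pos hq hr).ne'

theorem natDegree_poly : (poly K q r).natDegree = normExponent q r :=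
  natDegree_X_pow_sub_C

/-- The coordinate function `x` in the affine coordinate ring. -/
noncomputable def xA : CoordinateRing K q r := AdjoinRoot.root (poly K q r)

/-- The coordinate function `y` in the affine coordinate ring. -/
noncomputable def yA : CoordinateRing K q r := AdjoinRoot.of (poly K q r) X

/-- The coordinate function `y`. -/
noncomputable def y : FunctionField K q r :=
  algebraMap (CoordinateRing K q r) (FunctionField K q r) (yA K q r)

theorem algebraMap_xA :
    algebraMap (CoordinateRing K q r) (FunctionField K q r) (xA K q r) = x K q r := rfl

theorem algebraMap_yA :
    algebraMap (CoordinateRing K q r) (FunctionField K q r) (yA K q r) = y K q r := rfl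

theorem aeval_yA (p : K[X]) : aeval (yA K q r) p = AdjoinRoot.of (poly K q r) p := by
  have : aeval (yA K q r) = (Algebra.ofId K[X] (CoordinateRing K q r)).restrictScalars K := by
    ext
    simp [yA, Algebra.ofId_apply, AdjoinRoot.algebraMap_eq]
  rw [this]
  simp [Algebra.ofId_apply, AdjoinRoot.algebraMap_eq]

theorem xA_pow : xA K q r ^ normExponent q r = aeval (yA K q r) (tracePoly K q r) := by
  have h := AdjoinRoot.eval₂_root (poly K q r)
  rw [poly, eval₂_sub, eval₂_X_pow, eval₂_C, sub_eq_zero] at h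
  rw [aeval_yA]
  exact h

theorem x_pow : x K q r ^ normExponent q r = aeval (y K q r) (tracePoly K q r) := by
  rw [← algebraMap_xA, ← algebraMap_yA, ← map_pow, xA_pow, aeval_algebraMap_apply]

theorem coordinateRing_induction {C : CoordinateRing K q r → Prop}
    (hK : ∀ a : K, C (algebraMap K _ a)) (hx : C (xA K q r)) (hy : C (yA K q r))
    (hadd : ∀ f g, C f → C g → C (f + g)) (hmul : ∀ f g, C f → C g → C (f * g))
    (f : CoordinateRing K q r) : C f := by
  have hpow : ∀ f, C f → ∀ n : ℕ, C (f ^ n) := by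
    intro f hf n
    induction n with
    | zero => simpa using hK 1
    | succ n ih => rw [pow_succ]; exact hmul _ _ ih hf
  have hpoly : ∀ p : K[X], C (AdjoinRoot.of (poly K q r) p) := by
    intro p
    rw [← aeval_yA]
    induction p using Polynomial.induction_on' with
    | add p q hp hq => rw [map_add]; exact hadd _ _ hp hq
    | monomial n a => rw [aeval_monomial]; exact hmul _ _ (hK a) (hpow _ hy n)
  induction f using AdjoinRoot.induction_on with
  | ih p =>
    induction p using Polynomial.induction_on' with
    | add p q hp hq => rw [map_add]; exact hadd _ _ hp hq
    | monomial n a =>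
      rw [← C_mul_X_pow_eq_monomial, map_mul, map_pow]
      exact hmul _ _ (hpoly a) (hpow _ hx n)

theorem algebraMap_ne_zero {h : CoordinateRing K q r} (hh : h ≠ 0) :
    algebraMap _ (FunctionField K q r) h ≠ 0 := fun h0 =>
  hh ((injective_iff_map_eq_zero _).1
    (IsFractionRing.injective (CoordinateRing K q r) (FunctionField K q r)) _ h0)

theorem adjoin_xA_yA : Algebra.adjoin K {xA K q r, yA K q r} = ⊤ := by
  rw [eq_top_iff]
  intro f _
  induction f using coordinateRing_induction with
  | hK a => exact Subalgebra.algebraMap_mem _ a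
  | hx => exact Algebra.subset_adjoin (Or.inl rfl)
  | hy => exact Algebra.subset_adjoin (Or.inr rfl)
  | hadd f g hf hg => exact add_mem (hf trivial) (hg trivial)
  | hmul f g hf hg => exact mul_mem (hf trivial) (hg trivial)

variable [Fact (IsPrimePow q)] [NeZero r]

theorem one_lt_q (q : ℕ) [h : Fact (IsPrimePow q)] : 1 < q := h.out.one_lt

theorem normExponent_pos : 0 < normExponent q r := exponent_pos (one_lt_q q) (NeZero.ne r)

/-- The basis of the coordinate ring over `K[y]` made of the powers of `x`. -/
noncomputable def powerBasis : PowerBasis K[X] (CoordinateRing K q r) :=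
  AdjoinRoot.powerBasis' (monic_poly K q r (one_lt_q q) (NeZero.ne r))

theorem powerBasis_gen : (powerBasis K q r).gen = xA K q r := rfl

theorem powerBasis_dim : (powerBasis K q r).dim = normExponent q r := by
  rw [← natDegree_poly K q r]; rfl

/-- The basis of the coordinate ring over `K` made of the monomials `y^d x^i` with `i` less than
the exponent of the norm. -/
noncomputable def monomialBasis :
    Module.Basis (ℕ × Fin (powerBasis K q r).dim) K (CoordinateRing K q r) :=
  (Polynomial.basisMonomials K).smulTower (powerBasis K q r).basis

theorem monomialBasis_apply (j : ℕ × Fin (powerBasis K q r).dim) :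
    monomialBasis K q r j = yA K q r ^ j.1 * xA K q r ^ (j.2 : ℕ) := by
  rw [monomialBasis, Module.Basis.smulTower_apply, PowerBasis.basis_eq_pow, powerBasis_gen,
    Polynomial.coe_basisMonomials, Algebra.smul_def]
  congr 1
  rw [yA, ← map_pow, X_pow_eq_monomial]
  rfl

theorem monomialBasis_repr (f : CoordinateRing K q r) (j : ℕ × Fin (powerBasis K q r).dim) :
    (monomialBasis K q r).repr f j = ((powerBasis K q r).basis.repr f j.2).coeff j.1 := by
  rw [monomialBasis, Module.Basis.smulTower_repr]
  rfl

theorem adjoinRoot_of_injective :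
    Function.Injective (AdjoinRoot.of (poly K q r)) :=
  AdjoinRoot.of.injective_of_degree_ne_zero (by
    rw [degree_eq_natDegree (monic_poly K q r (one_lt_q q) (NeZero.ne r)).ne_zero,
      natDegree_poly]
    exact_mod_cast (normExponent_pos q r).ne')

theorem transcendental_y : Transcendental K (y K q r) := by
  rw [transcendental_iff]
  intro p hp
  rw [← algebraMap_yA, aeval_algebraMap_apply, aeval_yA] at hp
  have h1 := (injective_iff_map_eq_zero _).1
    (IsFractionRing.injective (CoordinateRing K q r) (FunctionField K q r)) _ hp
  exact (injective_iff_map_eq_zero _).1 (adjoinRoot_of_injective K q r) _ h1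

/-- Otherwise T(y) = x^N, and with it y, would be algebraic. -/
theorem transcendental_x : Transcendental K (x K q r) := by
  intro h
  have h1 := h.pow (normExponent q r)
  rw [x_pow] at h1
  exact transcendental_y K q r (h1.of_aeval _
    (by
      rw [natDegree_tracePoly K (one_lt_q q) (NeZero.ne r)]
      exact (pow_pos (one_lt_q q).le _).ne')
    (by rw [(monic_tracePoly K (one_lt_q q) (NeZero.ne r)).leadingCoeff]; exact one_mem _))

theorem x_ne_zero : x K q r ≠ 0 := fun h => transcendental_x K q r (h ▸ isAlgebraic_zero)

theorem exists_eq_div (f : FunctionField K q r) : ∃ g h : CoordinateRing K q r,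
    h ≠ 0 ∧ f = algebraMap _ _ g / algebraMap _ _ h := by
  obtain ⟨g, h, hh, e⟩ := IsFractionRing.div_surjective (CoordinateRing K q r) f
  exact ⟨g, h, nonZeroDivisors.ne_zero hh, e.symm⟩

theorem isIntegrallyClosed_coordinateRing (hqK : (q : K) = 0) :
    IsIntegrallyClosed (CoordinateRing K q r) := by
  have hTm := monic_tracePoly K (one_lt_q q) (NeZero.ne r)
  refine isIntegrallyClosed_of_adjoin_pair (F := FunctionField K q r) (transcendental_x K q r)
    (adjoin_xA_yA K q r) hTm ?_ (derivative_tracePoly K (NeZero.ne r) hqK) (xA_pow K q r).symm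
  rw [degree_eq_natDegree hTm.ne_zero, natDegree_tracePoly K (one_lt_q q) (NeZero.ne r)]
  exact_mod_cast pow_pos (one_lt_q q).le _

instance : Module.Finite K[X] (CoordinateRing K q r) := (powerBasis K q r).finite

/-- Finiteness over K[y] supplies the noetherian property and dimension at most one. -/
theorem isDedekindDomain_coordinateRing (hqK : (q : K) = 0) :
    IsDedekindDomain (CoordinateRing K q r) := by
  have := isIntegrallyClosed_coordinateRing K q r hqK
  have : IsNoetherianRing (CoordinateRing K q r) := IsNoetherianRing.of_finite K[X] _
  have : Ring.DimensionLEOne (CoordinateRing K q r) := Ring.DimensionLEOne.of_isIntegral K[X] _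
  exact { }

end NormTrace

/-! ### The place at infinity and pole orders. -/

namespace NormTrace

/-- The exponent is 1 + q + ⋯ + q^(r-1), which is 1 modulo q. -/
theorem coprime_normExponent {q r : ℕ} (hq : 1 < q) (hr : r ≠ 0) (n : ℕ) :
    Nat.Coprime (normExponent q r) (q ^ n) := by
  obtain ⟨m, rfl⟩ := Nat.exists_eq_succ_of_ne_zero hr
  refine Nat.Coprime.pow_right n ?_
  rw [normExponent, ← Nat.geomSum_eq hq, Finset.sum_range_succ']
  simp_rw [pow_succ q, ← Finset.sum_mul]
  simp

variable (K : Type*) [Field K] (q r : ℕ) [Fact (IsPrimePow q)] [NeZero r]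

/-- The pole order at infinity of the monomial `y^d x^i`. -/
def monomialWeight (j : ℕ × Fin (powerBasis K q r).dim) : ℕ :=
  normExponent q r * j.1 + q ^ (r - 1) * (j.2 : ℕ)

/-- Modulo N the weight is q^(r-1) i with q^(r-1) invertible, so it determines i < N, and then d. -/
theorem monomialWeight_injective : Function.Injective (monomialWeight K q r) := by
  rintro ⟨d, i⟩ ⟨d', i'⟩ h
  simp only [monomialWeight] at h
  have hN := normExponent_pos q r
  have hi := i.2.trans_eq (powerBasis_dim K q r)
  have hi' := i'.2.trans_eq (powerBasis_dim K q r)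
  have hmod : q ^ (r - 1) * (i : ℕ) ≡ q ^ (r - 1) * (i' : ℕ) [MOD normExponent q r] := by
    have := congrArg (· % normExponent q r) h
    simpa [Nat.ModEq, Nat.mul_add_mod] using this
  have hii : (i : ℕ) = i' := by
    have := Nat.ModEq.cancel_left_of_coprime
      (coprime_normExponent (one_lt_q q) (NeZero.ne r) (r - 1)) hmod
    rwa [Nat.ModEq, Nat.mod_eq_of_lt hi, Nat.mod_eq_of_lt hi'] at this
  have hdd : d = d' := by
    rw [hii, Nat.add_right_cancel_iff] at h
    exact Nat.eq_of_mul_eq_mul_left hN h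
  rw [Fin.ext hii, hdd]

/-- The pole order at infinity of a function that is regular on the affine curve. -/
noncomputable def weight (g : CoordinateRing K q r) : ℕ :=
  ((monomialBasis K q r).repr g).support.sup (monomialWeight K q r)

theorem monomialWeight_le_weight {g : CoordinateRing K q r}
    {j : ℕ × Fin (powerBasis K q r).dim} (h : (monomialBasis K q r).repr g j ≠ 0) :
    monomialWeight K q r j ≤ weight K q r g :=
  Finset.le_sup (Finsupp.mem_support_iff.2 h)

theorem exists_monomialWeight_eq {g : CoordinateRing K q r} (hg : g ≠ 0) :
    ∃ j, (monomialBasis K q r).repr g j ≠ 0 ∧ monomialWeight K q r j = weight K q r g := by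
  have hs : ((monomialBasis K q r).repr g).support.Nonempty := by
    rw [Finsupp.support_nonempty_iff]
    exact (map_ne_zero_iff _ (monomialBasis K q r).repr.injective).2 hg
  obtain ⟨j, hj, e⟩ := Finset.exists_mem_eq_sup _ hs (monomialWeight K q r)
  exact ⟨j, Finsupp.mem_support_iff.1 hj, e.symm⟩

section Valuation

variable {K q r} {V : ValuationSubring (FunctionField K q r)}

theorem valuation_algebraMap (hK : ∀ a : K, algebraMap K _ a ∈ V) {a : K} (ha : a ≠ 0) :
    V.valuation (algebraMap K _ a) = 1 := by
  refine le_antisymm ((V.valuation_le_one_iff _).2 (hK a)) ?_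
  have h := (V.valuation_le_one_iff _).2 (hK a⁻¹)
  rw [map_inv₀, map_inv₀] at h
  refine (inv_le_one₀ (zero_lt_iff.2 ?_)).1 h
  exact (Valuation.ne_zero_iff _).2 ((_root_.map_ne_zero _).2 ha)

/-- Since y has value greater than 1, the leading term of T(y) dominates. -/
theorem valuation_x_pow (hK : ∀ a : K, algebraMap K _ a ∈ V) (hy : y K q r ∉ V) :
    V.valuation (x K q r) ^ normExponent q r = V.valuation (y K q r) ^ q ^ (r - 1) := by
  have : V.valuation.IsTrivialOn K := ⟨fun a ha => valuation_algebraMap hK ha⟩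
  rw [← map_pow, x_pow, valuation_aeval_eq_valuation_X_pow_natDegree_of_one_lt_valuation_X,
    natDegree_tracePoly K (one_lt_q q) (NeZero.ne r)]
  · rw [← not_le, V.valuation_le_one_iff]
    exact hy
  · exact (monic_tracePoly K (one_lt_q q) (NeZero.ne r)).ne_zero

/-- A Bézout relation a q^(r-1) + b N = 1 gives u = x^a y^b, which plays the role of the inverse of
a uniformizer. -/
theorem exists_valuation_eq_pow (hK : ∀ a : K, algebraMap K _ a ∈ V) (hy : y K q r ∉ V) :
    ∃ u, 1 < V.valuation u ∧ V.valuation (y K q r) = V.valuation u ^ normExponent q r ∧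
      V.valuation (x K q r) = V.valuation u ^ q ^ (r - 1) := by
  have h := valuation_x_pow hK hy
  have hy1 : 1 < V.valuation (y K q r) := by
    rw [← not_le, V.valuation_le_one_iff]
    exact hy
  have hy0 : V.valuation (y K q r) ≠ 0 := (zero_lt_one.trans hy1).ne'
  have hx0 : V.valuation (x K q r) ≠ 0 := (Valuation.ne_zero_iff _).2 (x_ne_zero K q r)
  have hb := Nat.isCoprime_iff_coprime.2
    (coprime_normExponent (one_lt_q q) (NeZero.ne r) (r - 1))
  obtain ⟨b, a, hab⟩ := hb
  have e1 : V.valuation (y K q r) =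
      (V.valuation (x K q r ^ a * y K q r ^ b)) ^ normExponent q r := by
    rw [map_mul, map_zpow₀, map_zpow₀, mul_pow, ← zpow_natCast, ← zpow_natCast, ← zpow_mul,
      ← zpow_mul, mul_comm a, zpow_mul, zpow_natCast, h, ← zpow_natCast, ← zpow_mul,
      ← zpow_add₀ hy0, show ((q ^ (r - 1) : ℕ) : ℤ) * a + b * (normExponent q r : ℕ) = 1 by
        linarith, zpow_one]
  have e2 : V.valuation (x K q r) =
      (V.valuation (x K q r ^ a * y K q r ^ b)) ^ q ^ (r - 1) := by
    rw [map_mul, map_zpow₀, map_zpow₀, mul_pow, ← zpow_natCast, ← zpow_natCast, ← zpow_mul,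
      ← zpow_mul, mul_comm b, zpow_mul _ _ b, zpow_natCast _ (q ^ (r - 1)), ← h,
      ← zpow_natCast, ← zpow_mul,
      ← zpow_add₀ hx0, show a * ((q ^ (r - 1) : ℕ) : ℤ) + (normExponent q r : ℕ) * b = 1 by
        linarith, zpow_one]
  refine ⟨_, ?_, e1, e2⟩
  rw [e1] at hy1
  exact (one_lt_pow_iff_of_nonneg zero_le (normExponent_pos q r).ne').1 hy1

variable {u : FunctionField K q r}

theorem valuation_smul_monomialBasis (hK : ∀ a : K, algebraMap K _ a ∈ V)
    (huy : V.valuation (y K q r) = V.valuation u ^ normExponent q r)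
    (hux : V.valuation (x K q r) = V.valuation u ^ q ^ (r - 1)) {c : K} (hc : c ≠ 0)
    (j : ℕ × Fin (powerBasis K q r).dim) :
    V.valuation (algebraMap _ _ (c • monomialBasis K q r j)) =
      V.valuation u ^ monomialWeight K q r j := by
  rw [Algebra.smul_def, map_mul, map_mul, ← IsScalarTower.algebraMap_apply,
    valuation_algebraMap hK hc, one_mul, monomialBasis_apply, map_mul, map_pow, map_pow,
    map_mul, map_pow, map_pow, algebraMap_xA, algebraMap_yA, hux, huy, ← pow_mul, ← pow_mul,
    ← pow_add]
  rfl

theorem valuation_lt_of_forall (hK : ∀ a : K, algebraMap K _ a ∈ V) (hu : 1 < V.valuation u)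
    (huy : V.valuation (y K q r) = V.valuation u ^ normExponent q r)
    (hux : V.valuation (x K q r) = V.valuation u ^ q ^ (r - 1)) {g : CoordinateRing K q r}
    {m : ℕ} (h : ∀ j, (monomialBasis K q r).repr g j ≠ 0 → monomialWeight K q r j < m) :
    V.valuation (algebraMap _ _ g) < V.valuation u ^ m := by
  rw [← (monomialBasis K q r).linearCombination_repr g, Finsupp.linearCombination_apply,
    Finsupp.sum, map_sum]
  refine Valuation.map_sum_lt' _ (pow_pos (zero_lt_one.trans hu) _) fun j hj => ?_
  rw [Finsupp.mem_support_iff] at hj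
  rw [valuation_smul_monomialBasis hK huy hux hj]
  exact pow_lt_pow_right₀ hu (h j hj)

/-- Distinct basis monomials have distinct values, so no cancellation occurs and the largest term
decides. -/
theorem valuation_eq_pow_weight (hK : ∀ a : K, algebraMap K _ a ∈ V) (hu : 1 < V.valuation u)
    (huy : V.valuation (y K q r) = V.valuation u ^ normExponent q r)
    (hux : V.valuation (x K q r) = V.valuation u ^ q ^ (r - 1)) {g : CoordinateRing K q r}
    (hg : g ≠ 0) : V.valuation (algebraMap _ _ g) = V.valuation u ^ weight K q r g := by
  classical
  obtain ⟨j, hj, e⟩ := exists_monomialWeight_eq K q r hg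
  conv_lhs => rw [← (monomialBasis K q r).linearCombination_repr g,
    Finsupp.linearCombination_apply, Finsupp.sum, map_sum]
  rw [Valuation.map_sum_eq_of_lt _ (Finsupp.mem_support_iff.2 hj),
    valuation_smul_monomialBasis hK huy hux hj, e]
  intro k hk
  rw [Finset.mem_sdiff, Finsupp.mem_support_iff, Finset.mem_singleton] at hk
  rw [valuation_smul_monomialBasis hK huy hux hj, valuation_smul_monomialBasis hK huy hux hk.1]
  refine pow_lt_pow_right₀ hu (lt_of_le_of_ne ?_ ((monomialWeight_injective K q r).ne hk.2))
  rw [e]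
  exact monomialWeight_le_weight K q r hk.1

/-- The criterion does not mention V: this forces the uniqueness of the place at infinity. -/
theorem mem_iff_weight_le (hK : ∀ a : K, algebraMap K _ a ∈ V) (hy : y K q r ∉ V)
    {g h : CoordinateRing K q r} (hg : g ≠ 0) (hh : h ≠ 0) :
    (algebraMap _ _ g / algebraMap _ _ h : FunctionField K q r) ∈ V ↔
      weight K q r g ≤ weight K q r h := by
  obtain ⟨u, hu, huy, hux⟩ := exists_valuation_eq_pow hK hy
  rw [← V.valuation_le_one_iff, map_div₀, valuation_eq_pow_weight hK hu huy hux hg,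
    valuation_eq_pow_weight hK hu huy hux hh,
    div_le_one₀ (pow_pos (zero_lt_one.trans hu) _), pow_le_pow_iff_right₀ hu]

/-- A valuation ring of the function field over `K` that does not contain `y` is discrete. -/
theorem isDiscreteValuationRing_of_y_notMem (hK : ∀ a : K, algebraMap K _ a ∈ V)
    (hy : y K q r ∉ V) : IsDiscreteValuationRing V := by
  obtain ⟨u, hu, huy, hux⟩ := exists_valuation_eq_pow hK hy
  have hu0 : 0 < V.valuation u := zero_lt_one.trans hu
  -- The exponent is the difference of the weights of denominator and numerator, nonnegative because
  -- f lies in V.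
  have hval : ∀ f : V, f ≠ 0 → ∃ n : ℕ, V.valuation (f : FunctionField K q r) =
      (V.valuation u)⁻¹ ^ n := by
    rintro ⟨f, hf⟩ hf0
    have hf0' : f ≠ 0 := fun h => hf0 (Subtype.ext h)
    obtain ⟨g, h, hh, rfl⟩ := exists_eq_div K q r f
    have hg : g ≠ 0 := by
      rintro rfl
      rw [map_zero, zero_div] at hf0'
      exact hf0' rfl
    rw [mem_iff_weight_le hK hy hg hh] at hf
    refine ⟨weight K q r h - weight K q r g, ?_⟩
    rw [map_div₀, valuation_eq_pow_weight hK hu huy hux hg,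
      valuation_eq_pow_weight hK hu huy hux hh, inv_pow, div_eq_iff (pow_pos hu0 _).ne',
      eq_inv_mul_iff_mul_eq₀ (pow_pos hu0 _).ne', ← pow_add, Nat.sub_add_cancel hf]
  have hu1 : V.valuation u⁻¹ < 1 := by
    rw [map_inv₀]
    exact inv_lt_one_of_one_lt₀ hu
  have hunit : ∀ f : V, IsUnit f ↔ V.valuation (f : FunctionField K q r) = 1 :=
    V.valuation_eq_one_iff
  let t : V := ⟨u⁻¹, (V.valuation_le_one_iff _).1 hu1.le⟩
  have ht : V.valuation (t : FunctionField K q r) = (V.valuation u)⁻¹ := map_inv₀ _ _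
  have hlt : (V.valuation u)⁻¹ < 1 := inv_lt_one_of_one_lt₀ hu
  refine IsDiscreteValuationRing.ofHasUnitMulPowIrreducibleFactorization ⟨t, ?_, ?_⟩
  · refine ⟨fun h => ?_, fun a b hab => ?_⟩
    · rw [hunit, ht] at h
      exact hlt.ne h
    · have h0 : t ≠ 0 := by
        intro h
        have h2 := congrArg (fun f : V => V.valuation (f : FunctionField K q r)) h
        simp only [ht, ZeroMemClass.coe_zero, map_zero, inv_eq_zero] at h2
        exact hu0.ne' h2
      obtain ⟨m, hm⟩ := hval a (by rintro rfl; rw [zero_mul] at hab; exact h0 hab)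
      obtain ⟨n, hn⟩ := hval b (by rintro rfl; rw [mul_zero] at hab; exact h0 hab)
      have h1 : (V.valuation u)⁻¹ ^ 1 = (V.valuation u)⁻¹ ^ (m + n) := by
        rw [pow_one, pow_add, ← hm, ← hn, ← map_mul, ← ht, hab]
        rfl
      have h2 := pow_right_injective₀ (inv_pos.2 hu0) hlt.ne h1
      rw [hunit, hunit, hm, hn]
      rcases Nat.eq_zero_or_pos m with rfl | hm0
      · exact Or.inl (pow_zero _)
      · right
        obtain rfl : n = 0 := by omega
        exact pow_zero _
  · intro f hf
    obtain ⟨n, hn⟩ := hval f hf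
    refine ⟨n, ?_⟩
    obtain ⟨w, hw⟩ := (V.valuation_eq_iff (f : FunctionField K q r)
      ((t ^ n : V) : FunctionField K q r)).1 (by
        rw [hn, SubmonoidClass.coe_pow, map_pow, ht])
    exact ⟨w, Subtype.ext (by rw [mul_comm]; exact hw)⟩

end Valuation

/-- The integral closure of K in the function field omits the transcendental y, and an integrally
closed subring is separated from any element outside it by a valuation ring. -/
theorem exists_valuationSubring_y_notMem : ∃ V : ValuationSubring (FunctionField K q r),
    (∀ a : K, algebraMap K _ a ∈ V) ∧ y K q r ∉ V := by
  have : IsIntegrallyClosedIn (integralClosure K (FunctionField K q r)).toSubring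
      (FunctionField K q r) :=
    inferInstanceAs (IsIntegrallyClosedIn (integralClosure K (FunctionField K q r)) _)
  obtain ⟨V, hV, hy⟩ := Subring.exists_le_valuationSubring_of_isIntegrallyClosedIn
    (x := y K q r) (R := (integralClosure K (FunctionField K q r)).toSubring)
    (fun h => transcendental_y K q r (IsIntegral.isAlgebraic h))
  exact ⟨V, fun a => hV (Subalgebra.algebraMap_mem _ a), hy⟩

/-- The place at infinity. -/
noncomputable def infinityPlace : Place K (FunctionField K q r) where
  ring := (exists_valuationSubring_y_notMem K q r).choose
  algebraMap_mem := (exists_valuationSubring_y_notMem K q r).choose_spec.1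
  isDVR := isDiscreteValuationRing_of_y_notMem
    (exists_valuationSubring_y_notMem K q r).choose_spec.1
    (exists_valuationSubring_y_notMem K q r).choose_spec.2

theorem y_notMem_infinityPlace : y K q r ∉ (infinityPlace K q r).ring :=
  (exists_valuationSubring_y_notMem K q r).choose_spec.2

theorem eq_infinityPlace {P : Place K (FunctionField K q r)} (hP : y K q r ∉ P.ring) :
    P = infinityPlace K q r := by
  refine Place.ext_ring (SetLike.ext fun f => ?_)
  rcases eq_or_ne f 0 with rfl | hf
  · simp
  obtain ⟨g, h, hh, rfl⟩ := exists_eq_div K q r f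
  have hg : g ≠ 0 := by
    rintro rfl
    rw [map_zero, zero_div] at hf
    exact hf rfl
  rw [mem_iff_weight_le P.algebraMap_mem hP hg hh, mem_iff_weight_le
    (infinityPlace K q r).algebraMap_mem (y_notMem_infinityPlace K q r) hg hh]

/-- Read off from a valuation at infinity, which avoids reducing products of monomials modulo the
equation. -/
theorem weight_mul {g h : CoordinateRing K q r} (hg : g ≠ 0) (hh : h ≠ 0) :
    weight K q r (g * h) = weight K q r g + weight K q r h := by
  obtain ⟨V, hK, hy⟩ := exists_valuationSubring_y_notMem K q r
  obtain ⟨u, hu, huy, hux⟩ := exists_valuation_eq_pow hK hy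
  refine pow_right_injective₀ (zero_lt_one.trans hu) hu.ne' ?_
  change V.valuation u ^ _ = V.valuation u ^ _
  rw [pow_add, ← valuation_eq_pow_weight hK hu huy hux hg,
    ← valuation_eq_pow_weight hK hu huy hux hh,
    ← valuation_eq_pow_weight hK hu huy hux (mul_ne_zero hg hh), map_mul, map_mul]

theorem weight_xA : weight K q r (xA K q r) = q ^ (r - 1) := by
  obtain ⟨V, hK, hy⟩ := exists_valuationSubring_y_notMem K q r
  obtain ⟨u, hu, huy, hux⟩ := exists_valuation_eq_pow hK hy
  refine pow_right_injective₀ (zero_lt_one.trans hu) hu.ne' ?_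
  change V.valuation u ^ _ = V.valuation u ^ _
  rw [← hux, ← valuation_eq_pow_weight hK hu huy hux, algebraMap_xA]
  intro h
  exact x_ne_zero K q r (by rw [← algebraMap_xA, h, map_zero])

theorem weight_xA_pow (i : ℕ) : weight K q r (xA K q r ^ i) = q ^ (r - 1) * i := by
  have h0 : xA K q r ≠ 0 := fun h => x_ne_zero K q r (by rw [← algebraMap_xA, h, map_zero])
  induction i with
  | zero =>
    have h := weight_mul K q r (one_ne_zero) (one_ne_zero)
    rw [mul_one] at h
    rw [pow_zero]
    omega
  | succ i ih => rw [pow_succ, weight_mul K q r (pow_ne_zero i h0) h0, ih, weight_xA]; ring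

/-- If g and h have the same weight, their leading monomials coincide, and g/h takes as its value
the quotient of the leading coefficients. -/
theorem isRational_infinityPlace : (infinityPlace K q r).IsRational := by
  rw [Place.isRational_iff]
  set P := infinityPlace K q r
  have hK := P.algebraMap_mem
  obtain ⟨u, hu, huy, hux⟩ := exists_valuation_eq_pow hK (y_notMem_infinityPlace K q r)
  have hu0 : 0 < P.ring.valuation u := zero_lt_one.trans hu
  intro f hf
  rcases P.hasValue_zero_or_inv_mem f with h0 | ⟨h0, hinv⟩
  · exact ⟨0, h0⟩
  obtain ⟨g, h, hh, rfl⟩ := exists_eq_div K q r f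
  have hg : g ≠ 0 := by
    rintro rfl
    rw [map_zero, zero_div] at h0
    exact h0 rfl
  rw [inv_div, mem_iff_weight_le hK (y_notMem_infinityPlace K q r) hh hg] at hinv
  rw [mem_iff_weight_le hK (y_notMem_infinityPlace K q r) hg hh] at hf
  have hw := le_antisymm hf hinv
  obtain ⟨j, hj, ej⟩ := exists_monomialWeight_eq K q r hg
  obtain ⟨k, hk, ek⟩ := exists_monomialWeight_eq K q r hh
  obtain rfl : j = k := monomialWeight_injective K q r (by rw [ej, ek, hw])
  set B := monomialBasis K q r
  refine ⟨B.repr g j / B.repr h j, ?_⟩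
  rw [P.hasValue_iff_sub, P.hasValue_zero_iff_valuation_lt_one]
  have hlt : P.ring.valuation (algebraMap _ _ (g - (B.repr g j / B.repr h j) • h)) <
      P.ring.valuation u ^ weight K q r h := by
    refine valuation_lt_of_forall hK hu huy hux fun i hi => ?_
    rw [map_sub, map_smul, Finsupp.sub_apply, Finsupp.smul_apply, smul_eq_mul] at hi
    have hij : i ≠ j := by
      rintro rfl
      rw [div_mul_cancel₀ _ hk, sub_self] at hi
      exact hi rfl
    rw [← ek]
    refine lt_of_le_of_ne ?_ ((monomialWeight_injective K q r).ne hij)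
    by_cases hgi : B.repr g i = 0
    · rw [ek]
      refine monomialWeight_le_weight K q r (fun h => ?_)
      rw [hgi, h, mul_zero, sub_zero] at hi
      exact hi rfl
    · rw [ej]
      exact monomialWeight_le_weight K q r hgi
  have hh' := algebraMap_ne_zero K q r hh
  have e : algebraMap _ (FunctionField K q r) g / algebraMap _ _ h -
      algebraMap K _ (B.repr g j / B.repr h j) =
      algebraMap _ _ (g - (B.repr g j / B.repr h j) • h) / algebraMap _ _ h := by
    rw [map_sub, Algebra.smul_def, map_mul, ← IsScalarTower.algebraMap_apply, sub_div,
      mul_div_cancel_right₀ _ hh']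
  rw [e, map_div₀, valuation_eq_pow_weight hK hu huy hux hh, div_lt_one₀ (pow_pos hu0 _)]
  exact hlt

end NormTrace

/-! ### Zeros of regular functions, through the degree of the norm. -/

/-- In each term of the Leibniz formula the row and column weights run over the same multiset and
cancel. -/
theorem natDegree_det_le_of_weights {R n : Type*} [CommRing R] [IsDomain R] [Fintype n]
    [DecidableEq n] (M : Matrix n n R[X]) (w : n → ℕ) (N m : ℕ)
    (h : ∀ i j, M i j ≠ 0 → N * (M i j).natDegree + w i ≤ m + w j) :
    N * M.det.natDegree ≤ Fintype.card n * m := by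
  rcases Nat.eq_zero_or_pos N with rfl | hN
  · simp
  rw [mul_comm, ← Nat.le_div_iff_mul_le hN, Matrix.det_apply]
  refine natDegree_sum_le_of_forall_le _ _ fun σ _ => (natDegree_smul_le _ _).trans ?_
  rw [Nat.le_div_iff_mul_le hN, mul_comm]
  by_cases h0 : ∃ i, M (σ i) i = 0
  · obtain ⟨i, hi⟩ := h0
    rw [Finset.prod_eq_zero (f := fun i => M (σ i) i) (Finset.mem_univ i) hi, natDegree_zero]
    exact Nat.zero_le _
  push Not at h0
  rw [natDegree_prod _ _ fun i _ => h0 i]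
  have hsum := Finset.sum_le_sum fun i (_ : i ∈ Finset.univ) => h _ _ (h0 i)
  rw [Finset.sum_add_distrib, Finset.sum_add_distrib, ← Finset.mul_sum, Equiv.sum_comp σ w,
    Finset.sum_const, Finset.card_univ, smul_eq_mul] at hsum
  exact Nat.le_of_add_le_add_right hsum

namespace NormTrace

variable (K : Type*) [Field K] (q r : ℕ)

/-- The `K`-rational points of the affine norm-trace curve. -/
abbrev AffinePoint : Type _ :=
  {P : K × K // P.1 ^ normExponent q r = (tracePoly K q r).eval P.2}

variable {K q r}

/-- Evaluation of regular functions at a point of the affine curve. -/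
noncomputable def evalAt (P : AffinePoint K q r) : CoordinateRing K q r →ₐ[K] K :=
  AdjoinRoot.liftAlgHom (poly K q r) (aeval P.1.2) P.1.1 (by
    rw [poly, eval₂_sub, eval₂_X_pow, eval₂_C, sub_eq_zero, P.2]
    simp)

theorem evalAt_xA (P : AffinePoint K q r) : evalAt P (xA K q r) = P.1.1 :=
  AdjoinRoot.liftAlgHom_root ..

theorem evalAt_yA (P : AffinePoint K q r) : evalAt P (yA K q r) = P.1.2 := by
  rw [evalAt, yA, AdjoinRoot.liftAlgHom_of, aeval_X]

/-- The maximal ideal of the point (a, b) is generated by x - a and y - b; needed to show that x is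
a uniformizer at its zeros. -/
theorem sub_evalAt_mem_span (P : AffinePoint K q r) (g : CoordinateRing K q r) :
    g - algebraMap K _ (evalAt P g) ∈ Ideal.span
      {xA K q r - algebraMap K _ P.1.1, yA K q r - algebraMap K _ P.1.2} := by
  induction g using coordinateRing_induction with
  | hK a => rw [AlgHom.commutes]; simp
  | hx => rw [evalAt_xA]; exact Ideal.subset_span (Or.inl rfl)
  | hy => rw [evalAt_yA]; exact Ideal.subset_span (Or.inr rfl)
  | hadd f g hf hg =>
    rw [map_add, map_add, add_sub_add_comm]
    exact Ideal.add_mem _ hf hg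
  | hmul f g hf hg =>
    have e : f * g - algebraMap K _ (evalAt P (f * g)) =
        f * (g - algebraMap K _ (evalAt P g)) +
          algebraMap K _ (evalAt P g) * (f - algebraMap K _ (evalAt P f)) := by
      rw [map_mul, map_mul]; ring
    rw [e]
    exact Ideal.add_mem _ (Ideal.mul_mem_left _ _ hg) (Ideal.mul_mem_left _ _ hf)

theorem evalAt_injective : Function.Injective (evalAt : AffinePoint K q r → _) := by
  intro P Q h
  refine Subtype.ext (Prod.ext ?_ ?_)
  · rw [← evalAt_xA, h, evalAt_xA]
  · rw [← evalAt_yA, h, evalAt_yA]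

variable [Fact (IsPrimePow q)] [NeZero r]

theorem xA_ne_zero : xA K q r ≠ 0 := fun h =>
  x_ne_zero K q r (by rw [← algebraMap_xA, h, map_zero])

/-- The (i, j) entry of multiplication by g is the coefficient of x^i in g x^j. Its leading monomial
has weight at most weight g + q^(r-1) j, and the determinant bound applies with N rows. -/
theorem natDegree_norm_le_weight {g : CoordinateRing K q r} (hg : g ≠ 0) :
    (Algebra.norm K[X] g).natDegree ≤ weight K q r g := by
  set b := (powerBasis K q r).basis
  have h := natDegree_det_le_of_weights (Algebra.leftMulMatrix b g)
    (fun i => q ^ (r - 1) * (i : ℕ)) (normExponent q r) (weight K q r g) fun i j hij => by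
      have hM : Algebra.leftMulMatrix b g i j = b.repr (g * xA K q r ^ (j : ℕ)) i := by
        rw [Algebra.leftMulMatrix_eq_repr_mul, PowerBasis.basis_eq_pow, powerBasis_gen]
      have hne : (monomialBasis K q r).repr (g * xA K q r ^ (j : ℕ))
          ((Algebra.leftMulMatrix b g i j).natDegree, i) ≠ 0 := by
        rw [monomialBasis_repr, ← hM, coeff_natDegree, leadingCoeff_ne_zero]
        exact hij
      have := monomialWeight_le_weight K q r hne
      rwa [weight_mul K q r hg (pow_ne_zero _ xA_ne_zero), weight_xA_pow] at this
  rw [← Algebra.norm_eq_matrix_det b, Fintype.card_fin, powerBasis_dim] at h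
  exact Nat.le_of_mul_le_mul_left h (normExponent_pos q r)

/-- A regular function on the affine curve has at most as many rational zeros as its pole order
at infinity. -/
theorem card_zeros_le_weight {g : CoordinateRing K q r} (hg : g ≠ 0)
    (s : Finset (AffinePoint K q r)) (hs : ∀ P ∈ s, evalAt P g = 0) :
    s.card ≤ weight K q r g := by
  set b := (powerBasis K q r).basis
  have hI : Ideal.span {g} ≠ ⊥ := by rwa [Ne, Ideal.span_singleton_eq_bot]
  have : FiniteDimensional K (CoordinateRing K q r ⧸ Ideal.span {g}) :=
    Module.Finite.equiv (Ideal.quotientEquivDirectSum K b hI).symm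
  have hrank := finrank_quotient_span_eq_natDegree_norm (F := K) b hg
  refine le_trans ?_ (natDegree_norm_le_weight hg)
  rw [← hrank]
  -- Points where g vanishes give distinct characters of A/(g). Characters are linearly independent,
  -- so there are at most dim A/(g) of them.
  let φ : s → (CoordinateRing K q r ⧸ Ideal.span {g} →ₐ[K] K) := fun P =>
    Ideal.Quotient.liftₐ _ (evalAt P.1) fun a ha => by
      obtain ⟨c, rfl⟩ := Ideal.mem_span_singleton.1 ha
      rw [map_mul, hs P.1 P.2, zero_mul]
  have hφ : Function.Injective φ := by
    intro P Q h
    refine Subtype.ext (evalAt_injective (AlgHom.ext fun f => ?_))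
    exact DFunLike.congr_fun h (Ideal.Quotient.mk _ f)
  have h1 := (linearIndependent_toLinearMap K (CoordinateRing K q r ⧸ Ideal.span {g}) K).comp φ hφ
  have h2 := h1.fintype_card_le_finrank
  rwa [Fintype.card_coe, Module.finrank_linearMap, Module.finrank_self, mul_one] at h2

end NormTrace

/-! ### Counting rational points of the affine curve. -/

namespace NormTrace

section Counting

variable {K : Type*} [Field K] {q r : ℕ}

theorem eval_tracePoly (b : K) : (tracePoly K q r).eval b = ∑ i ∈ Finset.range r, b ^ q ^ i := by
  simp [tracePoly, eval_finsetSum]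

variable [Fintype K]

theorem natCast_q_eq_zero (hK : Fintype.card K = q ^ r) : (q : K) = 0 := by
  have h : ((q ^ r : ℕ) : K) = 0 := by rw [← hK, Nat.cast_card_eq_zero]
  rw [Nat.cast_pow] at h
  exact eq_zero_of_pow_eq_zero h

variable [hq : Fact (IsPrimePow q)]

/-- Raising to the power q shifts the summands b^(q^i) cyclically, because b^(q^r) = b. -/
theorem eval_tracePoly_pow (hK : Fintype.card K = q ^ r) (b : K) :
    (tracePoly K q r).eval b ^ q = (tracePoly K q r).eval b := by
  obtain ⟨p, k, hp, hk, hpk⟩ := (isPrimePow_nat_iff q).1 hq.out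
  have hpK : (p : K) = 0 := by
    have := natCast_q_eq_zero (K := K) hK
    rw [← hpk, Nat.cast_pow] at this
    exact eq_zero_of_pow_eq_zero this
  have : Fact p.Prime := ⟨hp⟩
  have : CharP K p := (CharP.charP_iff_prime_eq_zero hp).2 hpK
  have hb : b ^ q ^ r = b := by rw [← hK, FiniteField.pow_card]
  have hfrob : (∑ i ∈ Finset.range r, b ^ q ^ i) ^ q = ∑ i ∈ Finset.range r, b ^ q ^ (i + 1) := by
    simp_rw [pow_succ q, pow_mul b]
    rw [← hpk, sum_pow_char_pow]
  rw [eval_tracePoly, hfrob]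
  have h1 := Finset.sum_range_succ' (fun i => b ^ q ^ i) r
  rw [Finset.sum_range_succ, hb, pow_zero, pow_one] at h1
  exact (add_right_cancel h1).symm

variable [NeZero r]

theorem norm_pow (hK : Fintype.card K = q ^ r) (a : K) :
    (a ^ normExponent q r) ^ q = a ^ normExponent q r := by
  rcases eq_or_ne a 0 with rfl | ha
  · rw [zero_pow (normExponent_pos q r).ne', zero_pow hq.out.ne_zero]
  have hdiv : normExponent q r * (q - 1) = q ^ r - 1 := by
    have h := Nat.sub_dvd_pow_sub_pow q 1 r
    rw [one_pow] at h
    exact Nat.div_mul_cancel h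
  have h1 : (a ^ normExponent q r) ^ (q - 1) = 1 := by
    rw [← pow_mul, hdiv, ← hK, FiniteField.pow_card_sub_one_eq_one a ha]
  calc (a ^ normExponent q r) ^ q = (a ^ normExponent q r) ^ (q - 1 + 1) := by
        rw [Nat.sub_add_cancel (one_lt_q q).le]
    _ = a ^ normExponent q r := by rw [pow_succ, h1, one_mul]

variable [DecidableEq K]

theorem card_trace_fibre_le (c : K) :
    (Finset.univ.filter fun b : K => (tracePoly K q r).eval b = c).card ≤ q ^ (r - 1) := by
  have hm := monic_tracePoly K (one_lt_q q) (NeZero.ne r)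
  have hd := natDegree_tracePoly K (one_lt_q q) (NeZero.ne r)
  have hpos : 0 < (tracePoly K q r).degree := by
    rw [degree_eq_natDegree hm.ne_zero, hd]
    exact_mod_cast pow_pos (one_lt_q q).le _
  have h0 : tracePoly K q r - C c ≠ 0 :=
    (hm.sub_of_left (degree_C_le.trans_lt hpos)).ne_zero
  rw [← hd, ← natDegree_sub_C (a := c)]
  refine (Finset.card_le_card fun b hb => ?_).trans
    ((Multiset.toFinset_card_le _).trans (card_roots' (tracePoly K q r - C c)))
  rw [Finset.mem_filter] at hb
  rw [Multiset.mem_toFinset, mem_roots h0, IsRoot, eval_sub, eval_C, hb.2, sub_self]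

theorem card_fixed_le : (Finset.univ.filter fun c : K => c ^ q = c).card ≤ q := by
  have h0 : (X ^ q - X : K[X]) ≠ 0 := FiniteField.X_pow_card_sub_X_ne_zero K (one_lt_q q)
  refine (Finset.card_le_card fun b hb => ?_).trans
    ((Multiset.toFinset_card_le _).trans ((card_roots' (X ^ q - X : K[X])).trans_eq
      (FiniteField.X_pow_card_sub_X_natDegree_eq K (one_lt_q q))))
  rw [Finset.mem_filter] at hb
  rw [Multiset.mem_toFinset, mem_roots h0]
  simp [hb.2]

/-- The q^r elements of K fall into at most q fibres of at most q^(r-1) elements each, so every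
fibre is full. -/
theorem card_trace_fibre (hK : Fintype.card K = q ^ r) {c : K} (hc : c ^ q = c) :
    (Finset.univ.filter fun b : K => (tracePoly K q r).eval b = c).card = q ^ (r - 1) := by
  refine le_antisymm (card_trace_fibre_le c) ?_
  set S := Finset.univ.filter fun c : K => c ^ q = c
  have hcS : c ∈ S := Finset.mem_filter.2 ⟨Finset.mem_univ _, hc⟩
  have htotal := Finset.card_eq_sum_card_fiberwise (s := (Finset.univ : Finset K)) (t := S)
    (f := fun b => (tracePoly K q r).eval b)
    (fun b _ => Finset.mem_coe.2 (Finset.mem_filter.2 ⟨Finset.mem_univ _, eval_tracePoly_pow hK b⟩))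
  rw [Finset.card_univ, hK, ← Finset.add_sum_erase _ _ hcS] at htotal
  have hrest : ∑ x ∈ S.erase c,
      (Finset.univ.filter fun b : K => (tracePoly K q r).eval b = x).card ≤
        (q - 1) * q ^ (r - 1) := by
    refine (Finset.sum_le_card_nsmul _ _ _ fun x _ => card_trace_fibre_le x).trans ?_
    rw [smul_eq_mul, Finset.card_erase_of_mem hcS]
    exact Nat.mul_le_mul_right _ (Nat.sub_le_sub_right card_fixed_le 1)
  have hqr : q ^ r = q ^ (r - 1) + (q - 1) * q ^ (r - 1) := by
    obtain ⟨n, hn⟩ := Nat.exists_eq_succ_of_ne_zero (NeZero.ne r)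
    obtain ⟨m, hm⟩ := Nat.exists_eq_add_of_lt (one_lt_q q)
    rw [hn, hm]
    simp only [Nat.succ_eq_add_one, Nat.add_sub_cancel]
    ring
  omega

theorem card_affinePoint_filter (hK : Fintype.card K = q ^ r) (S : Finset K) :
    (Finset.univ.filter fun P : AffinePoint K q r => P.1.1 ∈ S).card = S.card * q ^ (r - 1) := by
  have h := Finset.card_eq_sum_card_fiberwise (f := fun P : AffinePoint K q r => P.1.1) (t := S)
    (s := Finset.univ.filter fun P : AffinePoint K q r => P.1.1 ∈ S)
    (fun P hP => (Finset.mem_filter.1 hP).2)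
  rw [h]
  refine Finset.sum_const_nat ?_
  intro a ha
  rw [← card_trace_fibre hK (norm_pow hK a)]
  refine Finset.card_bij (fun P _ => P.1.2) ?_ ?_ ?_
  · intro P hP
    rw [Finset.mem_filter] at hP ⊢
    exact ⟨Finset.mem_univ _, by rw [← P.2, hP.2]⟩
  · intro P hP Q hQ h
    rw [Finset.mem_filter] at hP hQ
    exact Subtype.ext (Prod.ext (hP.2.trans hQ.2.symm) h)
  · intro b hb
    refine ⟨⟨(a, b), (Finset.mem_filter.1 hb).2.symm⟩, ?_, rfl⟩
    simp [ha]

end Counting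

end NormTrace

/-! ### Places centred at affine points, and the zeros of x. -/

theorem Polynomial.prod_X_sub_C_eq_of_natDegree_le_card {K : Type*} [Field K] {p : K[X]}
    (hp : p.Monic) {S : Finset K} (hS : ∀ b ∈ S, p.IsRoot b) (hcard : p.natDegree ≤ S.card) :
    ∏ b ∈ S, (X - C b) = p := by
  refine (eq_of_monic_of_dvd_of_natDegree_le
    (monic_prod_of_monic _ _ fun b _ => monic_X_sub_C b) hp ?_ ?_).symm
  · refine Finset.prod_dvd_of_coprime ?_ fun b hb => dvd_iff_isRoot.2 (hS b hb)
    intro a _ b _ hab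
    exact pairwise_coprime_X_sub_C Function.injective_id hab
  · rwa [natDegree_prod_of_monic _ _ fun b _ => monic_X_sub_C b, Finset.sum_congr rfl
      fun b _ => natDegree_X_sub_C b, Finset.sum_const, smul_eq_mul, mul_one]

namespace NormTrace

open IsDedekindDomain HeightOneSpectrum

variable {K : Type*} [Field K] {q r : ℕ} [Fact (IsPrimePow q)] [NeZero r]

theorem x_notMem_infinityPlace : x K q r ∉ (infinityPlace K q r).ring := by
  have h := mem_iff_weight_le (infinityPlace K q r).algebraMap_mem
    (y_notMem_infinityPlace K q r) (xA_ne_zero (K := K) (q := q) (r := r)) one_ne_zero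
  have h1 := weight_xA_pow K q r 0
  rw [pow_zero, mul_zero] at h1
  rw [map_one, div_one, h1, weight_xA, algebraMap_xA] at h
  rw [h, not_le]
  exact pow_pos (one_lt_q q).le _

theorem x_mem_ring {Q : Place K (FunctionField K q r)} (hy : y K q r ∈ Q.ring) :
    x K q r ∈ Q.ring := by
  rw [← Q.val_le_one_iff, ← pow_le_one_iff (normExponent_pos q r).ne', ← map_pow, x_pow,
    Q.val_le_one_iff]
  let S : Subalgebra K (FunctionField K q r) :=
    { Q.ring.toSubring with algebraMap_mem' := Q.algebraMap_mem }
  exact (Algebra.adjoin_le (S := S) (by rintro _ rfl; exact hy) :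
    Algebra.adjoin K {y K q r} ≤ S) (aeval_mem_adjoin_singleton K _)

theorem algebraMap_mem_ring {Q : Place K (FunctionField K q r)} (hy : y K q r ∈ Q.ring)
    (g : CoordinateRing K q r) : algebraMap _ _ g ∈ Q.ring := by
  induction g using coordinateRing_induction with
  | hK a => rw [← IsScalarTower.algebraMap_apply]; exact Q.algebraMap_mem a
  | hx => exact x_mem_ring hy
  | hy => exact hy
  | hadd f g hf hg => rw [map_add]; exact add_mem hf hg
  | hmul f g hf hg => rw [map_mul]; exact mul_mem hf hg

/-- The place `Q` is centred at the point `P` of the affine curve. -/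
def IsCentredAt (Q : Place K (FunctionField K q r)) (P : AffinePoint K q r) : Prop :=
  Q.HasValue (x K q r) P.1.1 ∧ Q.HasValue (y K q r) P.1.2

theorem IsCentredAt.hasValue {Q : Place K (FunctionField K q r)} {P : AffinePoint K q r}
    (h : IsCentredAt Q P) (g : CoordinateRing K q r) :
    Q.HasValue (algebraMap _ _ g) (evalAt P g) := by
  induction g using coordinateRing_induction with
  | hK a =>
    rw [← IsScalarTower.algebraMap_apply, AlgHom.commutes]
    exact Q.hasValue_algebraMap a
  | hx => rw [evalAt_xA]; exact h.1
  | hy => rw [evalAt_yA]; exact h.2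
  | hadd f g hf hg => rw [map_add, map_add]; exact hf.add hg
  | hmul f g hf hg => rw [map_mul, map_mul]; exact hf.mul hg

theorem IsCentredAt.point_unique {Q : Place K (FunctionField K q r)} {P P' : AffinePoint K q r}
    (h : IsCentredAt Q P) (h' : IsCentredAt Q P') : P = P' :=
  Subtype.ext (Prod.ext (h.1.unique h'.1) (h.2.unique h'.2))

theorem exists_isCentredAt_of_hasValue {Q : Place K (FunctionField K q r)} {a b : K}
    (ha : Q.HasValue (x K q r) a) (hb : Q.HasValue (y K q r) b) :
    ∃ P : AffinePoint K q r, P.1 = (a, b) ∧ IsCentredAt Q P := by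
  have h1 := ha.pow (normExponent q r)
  rw [x_pow] at h1
  exact ⟨⟨(a, b), h1.unique (hb.aeval _)⟩, rfl, ha, hb⟩

theorem eq_infinityPlace_or_isCentredAt {Q : Place K (FunctionField K q r)}
    (hQ : Q.IsRational) : Q = infinityPlace K q r ∨ ∃ P, IsCentredAt Q P := by
  by_cases hy : y K q r ∈ Q.ring
  · rw [Place.isRational_iff] at hQ
    obtain ⟨a, ha⟩ := hQ _ (x_mem_ring hy)
    obtain ⟨b, hb⟩ := hQ _ hy
    obtain ⟨P, -, hP⟩ := exists_isCentredAt_of_hasValue ha hb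
    exact Or.inr ⟨P, hP⟩
  · exact Or.inl (eq_infinityPlace K q r hy)

/-- All the zeros of `x` are rational. -/
theorem exists_isCentredAt_of_hasValue_x_zero [Fintype K] (hK : Fintype.card K = q ^ r)
    {Q : Place K (FunctionField K q r)} (hx : Q.HasValue (x K q r) 0) :
    ∃ P : AffinePoint K q r, P.1.1 = 0 ∧ IsCentredAt Q P := by
  classical
  have hy : y K q r ∈ Q.ring := by
    by_contra hy
    rw [eq_infinityPlace K q r hy] at hx
    exact x_notMem_infinityPlace hx.1
  have hm := monic_tracePoly K (one_lt_q q) (NeZero.ne r)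
  -- The fibre of T over 0 has as many elements as the degree of T, so T splits over K with simple
  -- roots.
  have hprod : ∏ b ∈ Finset.univ.filter (fun b : K => (tracePoly K q r).eval b = 0),
      (X - C b) = tracePoly K q r := by
    refine prod_X_sub_C_eq_of_natDegree_le_card hm (fun b hb => (Finset.mem_filter.1 hb).2) ?_
    rw [natDegree_tracePoly K (one_lt_q q) (NeZero.ne r),
      card_trace_fibre hK (zero_pow (one_lt_q q).ne_bot)]
  have hval : Q.val (∏ b ∈ Finset.univ.filter (fun b : K => (tracePoly K q r).eval b = 0),
      (y K q r - algebraMap K _ b)) < 1 := by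
    rw [← Q.hasValue_zero_iff]
    have h1 := hx.pow (normExponent q r)
    rw [x_pow, zero_pow (normExponent_pos q r).ne', ← hprod, map_prod] at h1
    simpa using h1
  rw [map_prod] at hval
  obtain ⟨b, -, hb⟩ : ∃ b ∈ Finset.univ.filter (fun b : K => (tracePoly K q r).eval b = 0),
      Q.val (y K q r - algebraMap K _ b) < 1 := by
    -- The product of the y - b vanishes at Q, so some factor does; that b is the value of y.
    by_contra! hcon
    refine hval.not_ge ?_
    exact Finset.prod_induction _ (fun z => 1 ≤ z) (fun _ _ => one_le_mul) le_rfl hcon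
  rw [← Q.hasValue_zero_iff, ← Q.hasValue_iff_sub] at hb
  obtain ⟨P, e, hP⟩ := exists_isCentredAt_of_hasValue hx hb
  exact ⟨P, by rw [e], hP⟩

theorem xA_sub_ne_zero (a : K) : xA K q r - algebraMap K _ a ≠ 0 := by
  intro h
  refine transcendental_x K q r ?_
  rw [sub_eq_zero] at h
  rw [← algebraMap_xA, h, ← IsScalarTower.algebraMap_apply]
  exact isAlgebraic_algebraMap a

variable (q r) in
/-- The function `∏ (x - a) / x` over the elements `a` of `S`. -/
noncomputable def extremalFunction (S : Finset K) : FunctionField K q r :=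
  (∏ a ∈ S, (x K q r - algebraMap K _ a)) * ((x K q r)⁻¹) ^ S.card

theorem extremalFunction_ne_zero (S : Finset K) : extremalFunction q r S ≠ 0 := by
  refine mul_ne_zero (Finset.prod_ne_zero_iff.2 fun a _ h => ?_)
    (pow_ne_zero _ (inv_ne_zero (x_ne_zero K q r)))
  refine algebraMap_ne_zero K q r (xA_sub_ne_zero a) ?_
  rw [map_sub, algebraMap_xA, ← IsScalarTower.algebraMap_apply, h]

theorem extremalFunction_hasValue_zero {S : Finset K} (hS : 0 ∉ S)
    {Q : Place K (FunctionField K q r)} {P : AffinePoint K q r} (h : IsCentredAt Q P)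
    (hP : P.1.1 ∈ S) : Q.HasValue (extremalFunction q r S) 0 := by
  have hP0 : P.1.1 ≠ 0 := fun h0 => hS (h0 ▸ hP)
  have h1 := (Place.HasValue.prod S fun a _ => h.1.sub (Q.hasValue_algebraMap a)).mul
    ((h.1.inv hP0).pow S.card)
  rw [Finset.prod_eq_zero hP (sub_self _), zero_mul] at h1
  exact h1

/-- The maximal ideal of a rational point. -/
noncomputable def pointIdeal (P : AffinePoint K q r) :
    HeightOneSpectrum (CoordinateRing K q r) where
  asIdeal := RingHom.ker (evalAt P)
  isPrime := RingHom.ker_isPrime _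
  ne_bot := by
    refine Submodule.ne_bot_iff _ |>.2 ⟨xA K q r - algebraMap K _ P.1.1, ?_, xA_sub_ne_zero _⟩
    rw [RingHom.mem_ker, map_sub, evalAt_xA, AlgHom.commutes]
    exact sub_self _

theorem mem_pointIdeal {P : AffinePoint K q r} {g : CoordinateRing K q r} :
    g ∈ (pointIdeal P).asIdeal ↔ evalAt P g = 0 := RingHom.mem_ker

variable [IsDedekindDomain (CoordinateRing K q r)]

theorem mem_valuationSubringAtPrime_iff (v : HeightOneSpectrum (CoordinateRing K q r))
    {f : FunctionField K q r} : f ∈ valuationSubringAtPrime (FunctionField K q r) v ↔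
      ∃ g h : CoordinateRing K q r, h ∉ v.asIdeal ∧ f = algebraMap _ _ g / algebraMap _ _ h := by
  constructor
  · rintro ⟨g, h, hh, rfl⟩
    exact ⟨g, h, hh, (div_eq_mul_inv _ _).symm⟩
  · rintro ⟨g, h, hh, rfl⟩
    exact ⟨g, h, hh, (div_eq_mul_inv _ _)⟩

/-- The place of a maximal ideal of the coordinate ring. -/
noncomputable def placeOfPrime (v : HeightOneSpectrum (CoordinateRing K q r)) :
    Place K (FunctionField K q r) where
  ring := valuationSubringAtPrime (FunctionField K q r) v
  algebraMap_mem a := by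
    rw [mem_valuationSubringAtPrime_iff]
    refine ⟨algebraMap K _ a, 1, fun h => v.isPrime.ne_top ((Ideal.eq_top_iff_one _).2 h), ?_⟩
    rw [map_one, div_one, ← IsScalarTower.algebraMap_apply]
  isDVR := by
    have := v.isPrime
    exact IsLocalization.AtPrime.isDiscreteValuationRing_of_dedekind_domain _ v.ne_bot _

theorem algebraMap_mem_placeOfPrime (v : HeightOneSpectrum (CoordinateRing K q r))
    (g : CoordinateRing K q r) : algebraMap _ _ g ∈ (placeOfPrime v).ring :=
  (mem_valuationSubringAtPrime_iff v).2
    ⟨g, 1, fun h => v.isPrime.ne_top ((Ideal.eq_top_iff_one _).2 h), by rw [map_one, div_one]⟩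

/-- A function without poles on the affine curve belongs to the coordinate ring. -/
theorem exists_algebraMap_eq_of_forall_mem {f : FunctionField K q r}
    (hf : ∀ Q : Place K (FunctionField K q r), y K q r ∈ Q.ring → f ∈ Q.ring) :
    ∃ g : CoordinateRing K q r, algebraMap _ _ g = f := by
  -- A Dedekind domain is the intersection of its localizations at the height one primes, and y is
  -- regular at each of the corresponding places.
  refine mem_integers_of_valuation_le_one (FunctionField K q r) f fun v => ?_
  have h := hf (placeOfPrime v) (algebraMap_mem_placeOfPrime v _)
  exact valuationSubringAtPrime_le_valuation v h

theorem isCentredAt_placeOfPrime (P : AffinePoint K q r) :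
    IsCentredAt (placeOfPrime (pointIdeal P)) P := by
  have key : ∀ g : CoordinateRing K q r, evalAt P g = 0 →
      (placeOfPrime (pointIdeal P)).HasValue (algebraMap _ _ g) 0 := by
    intro g hg
    rcases (placeOfPrime (pointIdeal P)).hasValue_zero_or_inv_mem
      (algebraMap (CoordinateRing K q r) (FunctionField K q r) g) with h | ⟨h0, h⟩
    · exact h
    · obtain ⟨c, s, hs, e⟩ := (mem_valuationSubringAtPrime_iff _).1 h
      have hs0 : algebraMap _ (FunctionField K q r) s ≠ 0 :=
        algebraMap_ne_zero K q r (fun h => hs (h ▸ Ideal.zero_mem _))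
      rw [inv_eq_one_div, div_eq_div_iff h0 hs0, one_mul, ← map_mul] at e
      have e' := IsFractionRing.injective (CoordinateRing K q r) (FunctionField K q r) e
      exact absurd (mem_pointIdeal.2 (by rw [e', map_mul, hg, mul_zero])) hs
  constructor
  · rw [Place.hasValue_iff_sub, IsScalarTower.algebraMap_apply K (CoordinateRing K q r),
      ← algebraMap_xA, ← map_sub]
    refine key _ ?_
    rw [map_sub, evalAt_xA, AlgHom.commutes]
    exact sub_self _
  · rw [Place.hasValue_iff_sub, IsScalarTower.algebraMap_apply K (CoordinateRing K q r),
      ← algebraMap_yA, ← map_sub]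
    refine key _ ?_
    rw [map_sub, evalAt_yA, AlgHom.commutes]
    exact sub_self _

/-- Fractions whose denominator does not vanish at P are regular at Q. So the local ring of P lies
in the ring of Q, and a discrete valuation ring is a maximal proper subring of its field. -/
theorem IsCentredAt.eq_placeOfPrime {Q : Place K (FunctionField K q r)} {P : AffinePoint K q r}
    (h : IsCentredAt Q P) : Q = placeOfPrime (pointIdeal P) := by
  refine Place.ext_ring (Eq.symm ?_)
  refine ValuationSubring.eq_of_le_of_ne_top
    (A := valuationSubringAtPrime (FunctionField K q r) (pointIdeal P)) ?_ Q.ring_ne_top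
  intro f hf
  obtain ⟨c, s, hs, rfl⟩ := (mem_valuationSubringAtPrime_iff _).1 hf
  rw [mem_pointIdeal] at hs
  exact div_eq_mul_inv (algebraMap _ (FunctionField K q r) c) _ ▸
    mul_mem (h.hasValue c).1 ((h.hasValue s).inv hs).1

theorem IsCentredAt.exists_eq_div {Q : Place K (FunctionField K q r)} {P : AffinePoint K q r}
    (h : IsCentredAt Q P) {f : FunctionField K q r} (hf : f ∈ Q.ring) :
    ∃ g s : CoordinateRing K q r, evalAt P s ≠ 0 ∧ f = algebraMap _ _ g / algebraMap _ _ s := by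
  rw [h.eq_placeOfPrime] at hf
  obtain ⟨c, s, hs, e⟩ := (mem_valuationSubringAtPrime_iff _).1 hf
  exact ⟨c, s, fun h => hs (mem_pointIdeal.2 h), e⟩

theorem IsCentredAt.isRational {Q : Place K (FunctionField K q r)} {P : AffinePoint K q r}
    (h : IsCentredAt Q P) : Q.IsRational := by
  rw [Place.isRational_iff]
  intro f hf
  obtain ⟨g, s, hs, rfl⟩ := h.exists_eq_div hf
  rw [div_eq_mul_inv]
  exact ⟨_, (h.hasValue g).mul ((h.hasValue s).inv hs)⟩

/-- The function `x` is a uniformizer at its rational zeros. -/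
theorem IsCentredAt.val_x {Q : Place K (FunctionField K q r)} {P : AffinePoint K q r}
    (hqK : (q : K) = 0) (h : IsCentredAt Q P) (hP : P.1.1 = 0) :
    Q.val (x K q r) = WithZero.exp (-1) := by
  have hx := h.1
  rw [hP] at hx
  refine Q.val_eq_exp_neg_one_of_forall_dvd hx fun f hf => ?_
  obtain ⟨g, s, hs, rfl⟩ := h.exists_eq_div hf.1
  have hs0 : algebraMap _ (FunctionField K q r) s ≠ 0 :=
    algebraMap_ne_zero K q r (fun h => hs (by rw [h, map_zero]))
  have hg : evalAt P g = 0 := by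
    have h1 := hf.mul (h.hasValue s)
    rw [div_mul_cancel₀ _ hs0, zero_mul] at h1
    exact (h.hasValue g).unique h1
  have hmem := sub_evalAt_mem_span P g
  rw [hg, hP, map_zero, sub_zero, sub_zero, Ideal.mem_span_pair] at hmem
  obtain ⟨c, d, rfl⟩ := hmem
  have hroot : (tracePoly K q r).IsRoot P.1.2 := by
    rw [IsRoot, ← P.2, hP, zero_pow (normExponent_pos q r).ne']
  obtain ⟨U, hU⟩ := dvd_iff_isRoot.2 hroot
  -- With b the second coordinate of P, differentiating T = (Y - b)U at b gives U(b) = T'(b) = 1. So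
  -- U(y) is a unit at Q, and y - b = x^N / U(y) is a multiple of x.
  have hU1 : U.eval P.1.2 = 1 := by
    have := congrArg (fun p : K[X] => p.derivative.eval P.1.2) hU
    simpa [derivative_tracePoly K (NeZero.ne r) hqK] using this.symm
  have hUval : Q.HasValue (aeval (y K q r) U) 1 := hU1 ▸ h.2.aeval U
  have hU0 : aeval (y K q r) U ≠ 0 := by
    intro h0
    rw [h0] at hUval
    exact zero_ne_one ((by simpa using Q.hasValue_algebraMap (0 : K) :
      Q.HasValue 0 0).unique hUval)
  have hyU : y K q r - algebraMap K _ P.1.2 =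
      x K q r * (x K q r ^ (normExponent q r - 1) * (aeval (y K q r) U)⁻¹) := by
    have e := x_pow K q r
    rw [hU, map_mul, map_sub, aeval_X, aeval_C] at e
    rw [← mul_assoc, ← pow_succ', Nat.sub_add_cancel (normExponent_pos q r), e,
      mul_inv_cancel_right₀ hU0]
  have hyring := h.2.1
  refine ⟨(algebraMap _ _ c + algebraMap _ _ d *
    (x K q r ^ (normExponent q r - 1) * (aeval (y K q r) U)⁻¹)) * (algebraMap _ _ s)⁻¹, ?_, ?_⟩
  · exact mul_mem (add_mem (algebraMap_mem_ring hyring c) (mul_mem (algebraMap_mem_ring hyring d)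
      (mul_mem (pow_mem hx.1 _) (hUval.inv one_ne_zero).1))) ((h.hasValue s).inv hs).1
  · rw [map_add, map_mul, map_mul, map_sub, algebraMap_xA, algebraMap_yA,
      ← IsScalarTower.algebraMap_apply, hyU]
    ring

end NormTrace

/-! ### The divisors G and D, and the zeros of functions in L(G). -/

theorem Place.HasValue.inv_notMem {K F : Type*} [Field K] [Field F] [Algebra K F] {P : Place K F}
    {f : F} (hf : P.HasValue f 0) (h0 : f ≠ 0) : f⁻¹ ∉ P.ring := by
  rw [P.hasValue_zero_iff] at hf
  rw [← P.val_le_one_iff, map_inv₀, not_le,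
    one_lt_inv₀ (zero_lt_iff.2 ((Valuation.ne_zero_iff _).2 h0))]
  exact hf

theorem PlaceDivisor.sum_single_apply {K F : Type*} [Field K] [Field F] [Algebra K F]
    [DecidableEq (Place K F)] (s : Finset (Place K F)) (n : ℤ) (Q : Place K F) :
    (∑ P ∈ s, Finsupp.single P n : PlaceDivisor K F) Q = if Q ∈ s then n else 0 := by
  simp [Finsupp.finsetSum_apply, Finsupp.single_apply]

theorem PlaceDivisor.deg_sum_single {K F : Type*} [Field K] [Field F] [Algebra K F]
    (s : Finset (Place K F)) (hs : ∀ P ∈ s, P.IsRational) (n : ℤ) :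
    PlaceDivisor.deg (∑ P ∈ s, Finsupp.single P n) = s.card * n := by
  rw [PlaceDivisor.deg, ← Finsupp.sum_finsetSum_index (by simp) (by intros; ring)]
  rw [Finset.sum_congr rfl fun P hP => ?_, Finset.sum_const, nsmul_eq_mul]
  rw [Finsupp.sum_single_index (by simp), hs P hP]
  simp

theorem card_eq_zero_add_hammingNorm {ι K : Type*} [Fintype ι] [Field K] [DecidableEq K]
    (c : ι → K) : (Finset.univ.filter fun i => c i = 0).card + hammingNorm c = Fintype.card ι :=
  Finset.card_filter_add_card_filter_not _

namespace NormTrace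

variable {K : Type*} [Field K] {q r : ℕ} [Fact (IsPrimePow q)] [NeZero r]
  [IsDedekindDomain (CoordinateRing K q r)]

/-- The rational place centred at a point of the affine curve. -/
noncomputable def placeAt : AffinePoint K q r ↪ Place K (FunctionField K q r) where
  toFun P := placeOfPrime (pointIdeal P)
  inj' P P' h := (isCentredAt_placeOfPrime P).point_unique
    ((show placeOfPrime (pointIdeal P) = placeOfPrime (pointIdeal P') from h) ▸
      isCentredAt_placeOfPrime P')

theorem isCentredAt_placeAt (P : AffinePoint K q r) : IsCentredAt (placeAt P) P :=
  isCentredAt_placeOfPrime P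

theorem IsCentredAt.eq_placeAt {Q : Place K (FunctionField K q r)} {P : AffinePoint K q r}
    (h : IsCentredAt Q P) : Q = placeAt P := h.eq_placeOfPrime

theorem placeAt_ne_infinityPlace (P : AffinePoint K q r) : placeAt P ≠ infinityPlace K q r :=
  fun h => y_notMem_infinityPlace K q r (h ▸ (isCentredAt_placeAt P).2.1)

variable [Fintype K] [DecidableEq K]

variable (K q r) in
/-- The rational zeros of `x`. -/
noncomputable def zeroPlaces : Finset (Place K (FunctionField K q r)) :=
  (Finset.univ.filter fun P : AffinePoint K q r => P.1.1 ∈ ({0} : Finset K)).map placeAt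

variable (K q r) in
/-- The rational places at which `x` does not vanish. -/
noncomputable def nonzeroPlaces : Finset (Place K (FunctionField K q r)) :=
  Finset.cons (infinityPlace K q r)
    ((Finset.univ.filter fun P : AffinePoint K q r => P.1.1 ∈ Finset.univ.erase (0 : K)).map
      placeAt)
    (by
      rw [Finset.mem_map]
      rintro ⟨P, -, h⟩
      exact placeAt_ne_infinityPlace P h)

theorem mem_zeroPlaces {Q : Place K (FunctionField K q r)} :
    Q ∈ zeroPlaces K q r ↔ ∃ P : AffinePoint K q r, P.1.1 = 0 ∧ IsCentredAt Q P := by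
  rw [zeroPlaces, Finset.mem_map]
  constructor
  · rintro ⟨P, hP, rfl⟩
    exact ⟨P, by simpa using hP, isCentredAt_placeAt P⟩
  · rintro ⟨P, hP, h⟩
    exact ⟨P, by simpa using hP, h.eq_placeAt.symm⟩

theorem mem_nonzeroPlaces {Q : Place K (FunctionField K q r)} :
    Q ∈ nonzeroPlaces K q r ↔
      Q = infinityPlace K q r ∨ ∃ P : AffinePoint K q r, P.1.1 ≠ 0 ∧ IsCentredAt Q P := by
  rw [nonzeroPlaces, Finset.mem_cons, Finset.mem_map]
  refine or_congr_right ?_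
  constructor
  · rintro ⟨P, hP, rfl⟩
    exact ⟨P, by simpa using hP, isCentredAt_placeAt P⟩
  · rintro ⟨P, hP, h⟩
    exact ⟨P, by simpa using hP, h.eq_placeAt.symm⟩

theorem zerosOfX_eq : zerosOfX K q r = zeroPlaces K q r := by
  ext Q
  rw [Finset.mem_coe, mem_zeroPlaces]
  constructor
  · rintro ⟨hQ, hx⟩
    rw [Q.ord_pos_iff (x_ne_zero K q r)] at hx
    rcases eq_infinityPlace_or_isCentredAt hQ with rfl | ⟨P, hP⟩
    · exact absurd hx.1 x_notMem_infinityPlace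
    · exact ⟨P, hP.1.unique hx, hP⟩
  · rintro ⟨P, hP, h⟩
    exact ⟨h.isRational, (Q.ord_pos_iff (x_ne_zero K q r)).2 (hP ▸ h.1)⟩

theorem otherPlaces_eq : otherPlaces K q r = nonzeroPlaces K q r := by
  ext Q
  rw [otherPlaces, zerosOfX_eq, Set.mem_sdiff, Finset.mem_coe, Finset.mem_coe, mem_zeroPlaces,
    mem_nonzeroPlaces]
  constructor
  · rintro ⟨hQ, hx⟩
    rcases eq_infinityPlace_or_isCentredAt hQ with h | ⟨P, hP⟩
    · exact Or.inl h
    · exact Or.inr ⟨P, fun h => hx ⟨P, h, hP⟩, hP⟩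
  · rintro (rfl | ⟨P, hP, h⟩)
    · refine ⟨isRational_infinityPlace K q r, ?_⟩
      rintro ⟨P, -, h⟩
      exact y_notMem_infinityPlace K q r h.2.1
    · refine ⟨h.isRational, ?_⟩
      rintro ⟨P', hP', h'⟩
      exact hP (by rw [h.point_unique h', hP'])

theorem card_zeroPlaces (hK : Fintype.card K = q ^ r) :
    (zeroPlaces K q r).card = q ^ (r - 1) := by
  rw [zeroPlaces, Finset.card_map, card_affinePoint_filter hK, Finset.card_singleton, one_mul]

theorem card_nonzeroPlaces (hK : Fintype.card K = q ^ r) :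
    (nonzeroPlaces K q r).card = (q ^ r - 1) * q ^ (r - 1) + 1 := by
  rw [nonzeroPlaces, Finset.card_cons, Finset.card_map, card_affinePoint_filter hK,
    Finset.card_erase_of_mem (Finset.mem_univ _), Finset.card_univ, hK]

theorem divisorG_eq (l : ℕ) :
    divisorG K q r l = ∑ P ∈ zeroPlaces K q r, Finsupp.single P (l : ℤ) := by
  rw [divisorG, zerosOfX_eq, finsum_mem_coe_finset]

theorem divisorD_eq :
    divisorD K q r = ∑ P ∈ nonzeroPlaces K q r, Finsupp.single P 1 := by
  rw [divisorD, otherPlaces_eq, finsum_mem_coe_finset]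

theorem support_divisorD : (divisorD K q r).support = nonzeroPlaces K q r := by
  classical
  ext Q
  rw [Finsupp.mem_support_iff, divisorD_eq, PlaceDivisor.sum_single_apply]
  simp

theorem divisorG_apply_of_mem {l : ℕ} {Q : Place K (FunctionField K q r)}
    (h : Q ∈ zeroPlaces K q r) : divisorG K q r l Q = l := by
  classical
  rw [divisorG_eq, PlaceDivisor.sum_single_apply, if_pos h]

theorem divisorG_apply_of_notMem {l : ℕ} {Q : Place K (FunctionField K q r)}
    (h : Q ∉ zeroPlaces K q r) : divisorG K q r l Q = 0 := by
  classical
  rw [divisorG_eq, PlaceDivisor.sum_single_apply, if_neg h]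

theorem deg_divisorG (hK : Fintype.card K = q ^ r) (l : ℕ) :
    (divisorG K q r l).deg = l * q ^ (r - 1) := by
  rw [divisorG_eq, PlaceDivisor.deg_sum_single, card_zeroPlaces hK]
  · push_cast; ring
  · intro P hP
    obtain ⟨_, _, h⟩ := mem_zeroPlaces.1 hP
    exact h.isRational

theorem designedDistance_eq (hK : Fintype.card K = q ^ r) (l : ℕ) :
    designedDistance (divisorD K q r) (divisorG K q r l) =
      ((q ^ r - 1) * q ^ (r - 1) + 1 : ℕ) - ((l * q ^ (r - 1) : ℕ) : ℤ) := by
  rw [designedDistance, support_divisorD, card_nonzeroPlaces hK, deg_divisorG hK]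
  push_cast
  ring

theorem mem_ring_of_mem_riemannRochSpace {l : ℕ} {f : FunctionField K q r} (hf0 : f ≠ 0)
    (hf : f ∈ riemannRochSpace (divisorG K q r l)) {Q : Place K (FunctionField K q r)}
    (hQ : Q ∉ zeroPlaces K q r) : f ∈ Q.ring := by
  have h := hf.resolve_left hf0 Q
  rwa [divisorG_apply_of_notMem hQ, add_zero, Q.nonneg_ord_iff hf0] at h

theorem infinityPlace_notMem_zeroPlaces : infinityPlace K q r ∉ zeroPlaces K q r := by
  rw [mem_zeroPlaces]
  rintro ⟨P, -, h⟩
  exact y_notMem_infinityPlace K q r h.2.1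

/-- At the places of Ω a pole of order at most l is cancelled by x^l; only the vanishing of x is
used here, not the simplicity of its zeros. -/
theorem exists_algebraMap_eq_x_pow_mul {l : ℕ} {f : FunctionField K q r} (hf0 : f ≠ 0)
    (hf : f ∈ riemannRochSpace (divisorG K q r l)) :
    ∃ g : CoordinateRing K q r, algebraMap _ _ g = x K q r ^ l * f := by
  refine exists_algebraMap_eq_of_forall_mem fun Q hy => ?_
  by_cases hQ : Q ∈ zeroPlaces K q r
  · have h := hf.resolve_left hf0 Q
    rw [divisorG_apply_of_mem hQ, Q.nonneg_ord_add_iff hf0] at h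
    obtain ⟨P, hP, hc⟩ := mem_zeroPlaces.1 hQ
    have hx := hc.1
    rw [hP, ← Q.ord_pos_iff (x_ne_zero K q r), Place.ord] at hx
    have hx0 : Q.val (x K q r) ≠ 0 := (Valuation.ne_zero_iff _).2 (x_ne_zero K q r)
    have hx1 : Q.val (x K q r) ≤ WithZero.exp (-1) := by
      rw [← WithZero.log_le_iff_le_exp hx0]
      omega
    rw [← Q.val_le_one_iff, map_mul, map_pow]
    calc Q.val (x K q r) ^ l * Q.val f ≤ WithZero.exp (-1) ^ l * WithZero.exp (l : ℤ) :=
          mul_le_mul' (pow_le_pow_left' hx1 l) h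
      _ = 1 := by
          rw [← WithZero.exp_nsmul, ← WithZero.exp_add, ← WithZero.exp_zero]
          simp
  · exact mul_mem (pow_mem (x_mem_ring hy) l) (mem_ring_of_mem_riemannRochSpace hf0 hf hQ)

/-- A nonzero function of `L(G)` has at most `deg G` zeros among the rational places at which
`x` does not vanish. -/
theorem card_zeros_le {l : ℕ} {f : FunctionField K q r} (hf0 : f ≠ 0)
    (hf : f ∈ riemannRochSpace (divisorG K q r l)) (Z : Finset (Place K (FunctionField K q r)))
    (hZ : ∀ Q ∈ Z, Q ∈ nonzeroPlaces K q r ∧ Q.HasValue f 0) :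
    Z.card ≤ l * q ^ (r - 1) := by
  classical
  obtain ⟨g, hg⟩ := exists_algebraMap_eq_x_pow_mul hf0 hf
  have hx0 := x_ne_zero K q r
  have hg0 : g ≠ 0 := by
    rintro rfl
    rw [map_zero] at hg
    exact mul_ne_zero (pow_ne_zero l hx0) hf0 hg.symm
  have hxl : xA K q r ^ l ≠ 0 := pow_ne_zero _ xA_ne_zero
  have hfdiv : f = algebraMap _ _ g / algebraMap _ _ (xA K q r ^ l) := by
    rw [hg, map_pow, algebraMap_xA, mul_div_cancel_left₀ _ (pow_ne_zero l hx0)]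
  have hK := (infinityPlace K q r).algebraMap_mem
  have hy := y_notMem_infinityPlace K q r
  have hw : weight K q r g ≤ q ^ (r - 1) * l := by
    have h := mem_ring_of_mem_riemannRochSpace hf0 hf infinityPlace_notMem_zeroPlaces
    rwa [hfdiv, mem_iff_weight_le hK hy hg0 hxl, weight_xA_pow] at h
  let Z' := Finset.univ.filter fun P : AffinePoint K q r => placeAt P ∈ Z
  have hZ' : Z'.card ≤ weight K q r g := by
    refine card_zeros_le_weight hg0 Z' fun P hP => ?_
    have h1 := (hZ _ (Finset.mem_filter.1 hP).2).2
    have h2 := ((isCentredAt_placeAt P).1.pow l).mul h1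
    rw [mul_zero, ← hg] at h2
    exact ((isCentredAt_placeAt P).hasValue g).unique h2
  have hsub : Z.erase (infinityPlace K q r) ⊆ Z'.map placeAt := by
    intro Q hQ
    rw [Finset.mem_erase] at hQ
    rcases mem_nonzeroPlaces.1 (hZ Q hQ.2).1 with h | ⟨P, -, h⟩
    · exact absurd h hQ.1
    · rw [Finset.mem_map]
      exact ⟨P, Finset.mem_filter.2 ⟨Finset.mem_univ _, h.eq_placeAt ▸ hQ.2⟩, h.eq_placeAt.symm⟩
  have hcard := Finset.card_le_card hsub
  rw [Finset.card_map] at hcard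
  rw [mul_comm l]
  by_cases hinf : infinityPlace K q r ∈ Z
  · have hw' : weight K q r g < q ^ (r - 1) * l := by
      have h := (hZ _ hinf).2.inv_notMem hf0
      rwa [hfdiv, inv_div, mem_iff_weight_le hK hy hxl hg0, weight_xA_pow, not_le] at h
    rw [Finset.card_erase_of_mem hinf] at hcard
    omega
  · rw [Finset.erase_eq_of_notMem hinf] at hcard
    omega

/-- On Ω the pole order is at most |S| because x has simple zeros. At other affine places x is
invertible, since all its zeros are rational. At infinity each factor is 1 - a/x, which is regular.
-/
theorem extremalFunction_mem (hK : Fintype.card K = q ^ r) (S : Finset K) :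
    extremalFunction q r S ∈ riemannRochSpace (divisorG K q r S.card) := by
  refine Or.inr fun Q => ?_
  have hf0 := extremalFunction_ne_zero (q := q) (r := r) S
  by_cases hy : y K q r ∈ Q.ring
  · have hx := x_mem_ring hy
    have hnum : ∏ a ∈ S, (x K q r - algebraMap K _ a) ∈ Q.ring :=
      prod_mem fun a _ => sub_mem hx (Q.algebraMap_mem a)
    by_cases hQ : Q ∈ zeroPlaces K q r
    · rw [divisorG_apply_of_mem hQ, Q.nonneg_ord_add_iff hf0, extremalFunction, map_mul, map_pow,
        map_inv₀]
      obtain ⟨P, hP, h⟩ := mem_zeroPlaces.1 hQ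
      rw [h.val_x (natCast_q_eq_zero hK) hP, ← WithZero.exp_neg, neg_neg, ← WithZero.exp_nsmul,
        nsmul_one]
      exact mul_le_of_le_one_left' (Q.val_le_one_iff.2 hnum)
    · rw [divisorG_apply_of_notMem hQ, add_zero, Q.nonneg_ord_iff hf0]
      rcases Q.hasValue_zero_or_inv_mem (x K q r) with h | ⟨-, h⟩
      · exact absurd (mem_zeroPlaces.2 (exists_isCentredAt_of_hasValue_x_zero hK h)) hQ
      · exact mul_mem hnum (pow_mem h _)
  · have hQ := eq_infinityPlace K q r hy
    have hQ' : Q ∉ zeroPlaces K q r := hQ ▸ infinityPlace_notMem_zeroPlaces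
    have hx : x K q r ∉ Q.ring := hQ ▸ x_notMem_infinityPlace
    rw [divisorG_apply_of_notMem hQ', add_zero, Q.nonneg_ord_iff hf0, extremalFunction,
      ← Finset.prod_const, ← Finset.prod_mul_distrib]
    refine prod_mem fun a _ => ?_
    have hinv := (Q.ring.mem_or_inv_mem (x K q r)).resolve_left hx
    rw [sub_mul, mul_inv_cancel₀ (x_ne_zero K q r)]
    exact sub_mem (one_mem _) (mul_mem (Q.algebraMap_mem a) hinv)

end NormTrace

theorem mainTheorem5 (q r l : ℕ) [Fact (IsPrimePow q)] [NeZero r] (hr : 3 ≤ r)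
    (K : Type*) [Field K] [Fintype K] [DecidableEq K] (hK : Fintype.card K = q ^ r) :
    (NormTrace.zerosOfX K q r).Finite ∧
    (NormTrace.otherPlaces K q r).Finite ∧
    designedDistance (NormTrace.divisorD K q r) (NormTrace.divisorG K q r l)
      = (q : ℤ) ^ (2 * r - 1) + 1 - ((l : ℤ) + 1) * (q : ℤ) ^ (r - 1) ∧
    (0 < designedDistance (NormTrace.divisorD K q r) (NormTrace.divisorG K q r l) →
      IsMinimumDistance
        (functionalCode (NormTrace.divisorD K q r) (NormTrace.divisorG K q r l))
        (designedDistance (NormTrace.divisorD K q r) (NormTrace.divisorG K q r l))) := by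
  open NormTrace in
  have hDed : IsDedekindDomain (CoordinateRing K q r) :=
    isDedekindDomain_coordinateRing K q r (natCast_q_eq_zero hK)
  have hs : 0 < q ^ (r - 1) := pow_pos (one_lt_q q).le _
  have hqr : 0 < q ^ r := pow_pos (one_lt_q q).le _
  refine ⟨?_, ?_, ?_, ?_⟩
  · rw [zerosOfX_eq]
    exact Finset.finite_toSet _
  · rw [otherPlaces_eq]
    exact Finset.finite_toSet _
  · rw [designedDistance_eq hK, show 2 * r - 1 = r + (r - 1) by omega]
    push_cast [Nat.cast_sub hqr]
    ring
  intro hpos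
  have hn : Fintype.card (divisorD K q r).support = (q ^ r - 1) * q ^ (r - 1) + 1 := by
    rw [Fintype.card_coe, support_divisorD, card_nonzeroPlaces hK]
  have hupper : ∀ f ∈ riemannRochSpace (divisorG K q r l), f ≠ 0 →
      ∀ c : (divisorD K q r).support → K, (∀ Q : (divisorD K q r).support, Q.1.HasValue f (c Q)) →
      (Finset.univ.filter fun Q => c Q = 0).card ≤ l * q ^ (r - 1) := by
    intro f hf hf0 c hc
    rw [← Finset.card_map (Function.Embedding.subtype _)]
    refine card_zeros_le hf0 hf _ fun Q hQ => ?_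
    obtain ⟨Q', hQ', rfl⟩ := Finset.mem_map.1 hQ
    refine ⟨support_divisorD (K := K) (q := q) (r := r) ▸ Q'.2, ?_⟩
    have := hc Q'
    rwa [(Finset.mem_filter.1 hQ').2] at this
  rw [designedDistance_eq hK] at hpos ⊢
  constructor
  · have hl : l ≤ (Finset.univ.erase (0 : K)).card := by
      rw [Finset.card_erase_of_mem (Finset.mem_univ _), Finset.card_univ, hK]
      by_contra! hcon
      have h1 : (q ^ r - 1 + 1) * q ^ (r - 1) ≤ l * q ^ (r - 1) := Nat.mul_le_mul_right _ hcon
      rw [add_mul, one_mul] at h1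
      omega
    obtain ⟨S, hS, rfl⟩ := Finset.exists_subset_card_eq hl
    have hS0 : (0 : K) ∉ S := fun h => Finset.notMem_erase _ _ (hS h)
    have hf := extremalFunction_mem hK S
    have hf0 := extremalFunction_ne_zero (q := q) (r := r) S
    have hval : ∀ Q : (divisorD K q r).support, ∃ a, Q.1.HasValue (extremalFunction q r S) a := by
      rintro ⟨Q, hQ⟩
      rw [support_divisorD, ← Finset.mem_coe, ← otherPlaces_eq] at hQ
      refine (Q.isRational_iff.1 hQ.1) _ (mem_ring_of_mem_riemannRochSpace hf0 hf fun h => ?_)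
      exact hQ.2 (by rw [zerosOfX_eq]; exact h)
    choose c hc using hval
    have hle := hupper _ hf hf0 c hc
    -- The q^(r-1) points above each a in S are distinct zeros.
    have hge : S.card * q ^ (r - 1) ≤ (Finset.univ.filter fun Q => c Q = 0).card := by
      rw [← card_affinePoint_filter hK S, ← Finset.card_map placeAt,
        ← Finset.card_map (Function.Embedding.subtype _)]
      refine Finset.card_le_card fun Q hQ => ?_
      obtain ⟨P, hP, rfl⟩ := Finset.mem_map.1 hQ
      have hPS := (Finset.mem_filter.1 hP).2
      have hmem : placeAt P ∈ (divisorD K q r).support := by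
        rw [support_divisorD, mem_nonzeroPlaces]
        exact Or.inr ⟨P, fun h => hS0 (h ▸ hPS), isCentredAt_placeAt P⟩
      refine Finset.mem_map.2 ⟨⟨placeAt P, hmem⟩, Finset.mem_filter.2 ⟨Finset.mem_univ _, ?_⟩, rfl⟩
      exact (hc ⟨placeAt P, hmem⟩).unique
        (extremalFunction_hasValue_zero hS0 (isCentredAt_placeAt P) hPS)
    have hsum := card_eq_zero_add_hammingNorm c
    rw [hn] at hsum
    refine ⟨c, ⟨_, hf, hc⟩, 0, Submodule.zero_mem _, ?_, ?_⟩
    -- The zero word would have as many zeros as coordinates, more than deg G because d* > 0.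
    · rintro rfl
      rw [hammingNorm_zero] at hsum
      omega
    · rw [hammingDist_zero_right]
      omega
  · rintro _ ⟨c, hcC, c', hcC', hne, rfl⟩
    -- By linearity the difference of the codewords comes from a single f in L(G), and its weight is
    -- their distance.
    obtain ⟨f, hf, hfc⟩ := Submodule.sub_mem _ hcC hcC'
    have hf0 : f ≠ 0 := by
      rintro rfl
      refine hne (sub_eq_zero.1 (funext fun Q => (hfc Q).unique ?_))
      simpa using Q.1.hasValue_algebraMap (0 : K)
    have hle := hupper f hf hf0 _ hfc
    have hsum := card_eq_zero_add_hammingNorm (c - c')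
    rw [hn] at hsum
    rw [hammingDist_comm, hammingDist_eq_hammingNorm, neg_add_eq_sub]
    omega
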